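/- Let $q:\mathbb{R}^2\to\mathbb{R}$ satisfy, for some $\beta>\frac52$: 1. $q\in\mathcal{C}^4(\mathbb{R}^2)$, and $\partial^{a}q\in L^2(\mathbb{R}^2)$ for every $a=(a_1,a_2)\in\mathbb{N}^2$ with $a_1+a_2\le 4$; 2. $q(z)=q(-z)$ for all $z\in\mathbb{R}^2$; 3. there is a constant $C>0$ with $|\partial^{a}q(z)|\le C\|z\|^{-\beta}$ for all $a\in\mathbb{N}^2$ with $a_1+a_2\le 2$ and all $\|z\|\ge 1$; 4. $(q*q)(0)>0$. Let $W$ be a white noise on $\mathbb{R}^2$, that is, a centered Gaussian process indexed by $L^2(\mathbb{R}^2)$ with $\mathbb{E}[W(\varphi)W(\psi)]=\langle\varphi,\psi\rangle_{L^2}$, and let $f=q*W$, that is, $f(z)=W(q(\cdot-z))$ almost surely for each $z\in\mathbb{R}^2$, where $f$ denotes a modification whose sample paths are almost surely of class $\mathcal{C}^2$. Write $e_1=(1,0)$. For a $\mathcal{C}^1$ function $g:\mathbb{R}^2\to\mathbb{R}^m$, $t\ge0$ and $z\in\mathbb{R}^2$ put $$\tau_g(t,z)=\begin{cases}\dfrac{g(z+te_1)-g(z)}{t}&\text{if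 }t>0,\\[2mm] \dfrac{\partial g}{\partial z_1}(z)&\text{if }t=0,\end{cases}$$ and let $\alpha(z)=\sup_{t\ge 0}\tau_f(t,z)$ be the slope field of $f$. Then there is a random variable $T$ such that, almost surely, the following holds: $\alpha(z)<+\infty$ for every $z\in\mathbb{R}^2$; $T\ge 0$, and $T$ is the unique $t\in[0,+\infty)$ with $\alpha(0)=\tau_f(t,0)$; and $\alpha$ is differentiable at $0$ with $$\nabla\alpha(0)=\tau_{\nabla f}(T,0).$$ -/

import Mathlib

open MeasureTheory ProbabilityTheory Filter
open scoped Gradient Convolution ENNReal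

/-- The Euclidean plane. -/
abbrev Plane : Type := EuclideanSpace ℝ (Fin 2)

/-- The `i`-th vector of the canonical basis of the plane; `unitVec 0` is the vector `e₁`. -/
noncomputable def unitVec (i : Fin 2) : Plane := EuclideanSpace.single i 1

/-- The partial derivative of `g` in the `i`-th coordinate direction. -/
noncomputable def partialDeriv (i : Fin 2) (g : Plane → ℝ) (z : Plane) : ℝ :=
  fderiv ℝ g z (unitVec i)

/-- The mixed partial derivative `∂^(a, b) g`, of order `a + b`. -/
noncomputable def mixedDeriv (a b : ℕ) (g : Plane → ℝ) : Plane → ℝ :=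
  (partialDeriv 0)^[a] ((partialDeriv 1)^[b] g)

/-- The standing assumption on the convolution kernel `q`. -/
structure IsAdmissibleKernel (q : Plane → ℝ) : Prop where
  contDiff : ContDiff ℝ 4 q
  memLp : ∀ a b : ℕ, a + b ≤ 4 → MemLp (mixedDeriv a b q) 2 volume
  even : ∀ z, q z = q (-z)
  decay : ∃ β : ℝ, 5 / 2 < β ∧ ∃ C : ℝ, 0 < C ∧
    ∀ a b : ℕ, a + b ≤ 2 → ∀ z : Plane, 1 ≤ ‖z‖ → |mixedDeriv a b q z| ≤ C / ‖z‖ ^ β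
  convolution_pos : 0 < (q ⋆[ContinuousLinearMap.mul ℝ ℝ, volume] q) 0

/-- An admissible kernel is square integrable. -/
theorem IsAdmissibleKernel.memLp_self {q : Plane → ℝ} (hq : IsAdmissibleKernel q) :
    MemLp q 2 (volume : Measure Plane) :=
  hq.memLp 0 0 (Nat.zero_le 4)

/-- The translate `q(· - z)` as an element of `L²(ℝ²)`. -/
noncomputable def translateL2 {q : Plane → ℝ} (hq : MemLp q 2 (volume : Measure Plane))
    (z : Plane) : Lp ℝ 2 (volume : Measure Plane) :=
  (hq.comp_measurePreserving (measurePreserving_sub_right volume z)).toLp (fun x => q (x - z))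

/-- `W` is a white noise on the plane: a centered Gaussian process indexed by `L²(ℝ²)` whose
covariance is the scalar product of `L²(ℝ²)`. -/
structure IsWhiteNoise {Ω : Type*} [MeasurableSpace Ω] (P : Measure Ω)
    (W : Lp ℝ 2 (volume : Measure Plane) → Ω → ℝ) : Prop where
  isGaussianProcess : IsGaussianProcess W P
  centered : ∀ φ, ∫ ω, W φ ω ∂P = 0
  covariance : ∀ φ ψ, ∫ ω, W φ ω * W ψ ω ∂P = inner ℝ φ ψ

/-- `f` is the random field `q ∗ W`, that is, `f(z) = W(q(· - z))` almost surely for every fixed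
`z`, in a modification whose sample paths are almost surely of class `C²`. -/
structure IsConvolvedNoise {Ω : Type*} [MeasurableSpace Ω] (P : Measure Ω)
    (W : Lp ℝ 2 (volume : Measure Plane) → Ω → ℝ) {q : Plane → ℝ}
    (hq : MemLp q 2 (volume : Measure Plane)) (f : Ω → Plane → ℝ) : Prop where
  ae_eq : ∀ z, ∀ᵐ ω ∂P, f ω z = W (translateL2 hq z) ω
  ae_contDiff : ∀ᵐ ω ∂P, ContDiff ℝ 2 (f ω)

/-- The slope function `τ_g(t, z)`, for `t ≥ 0`: the difference quotient of `g` at `z` in direction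
`e₁` if `t > 0`, and the partial derivative of `g` at `z` in that direction if `t = 0`. -/
noncomputable def tau {F : Type*} [NormedAddCommGroup F] [NormedSpace ℝ F]
    (g : Plane → F) (t : ℝ) (z : Plane) : F :=
  if 0 < t then t⁻¹ • (g (z + t • unitVec 0) - g z) else fderiv ℝ g z (unitVec 0)

/-- The slope field `α(z) = sup_{t ≥ 0} τ_g(t, z)` of `g`. (A real supremum: it is the genuine one
where the set of slopes is bounded above.) -/
noncomputable def slopeField (g : Plane → ℝ) (z : Plane) : ℝ :=
  ⨆ t : Set.Ici (0 : ℝ), tau g t z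

/-! The supremum is differentiated by Danskin's theorem (`hasFDerivAt_iSup_of_unique_max`): where a
single index attains the supremum, and distant indices stay below it nearby, the supremum has the
derivative of that index. Since differentiation in z turns the slopes of f into those of ∇f, two
almost sure facts remain: coercivity in t and uniqueness of the maximizer.

Coercivity. By stationarity the translates of f by n e₁ have the same law on a ball, so a Fernique
bound with common constants and Borel–Cantelli give growth at most √n along the axis
(`IsConvolvedNoise.ae_hasSqrtGrowth`). Slopes at large t are then below any given positive level,
locally uniformly in z. The maximal slope at 0 is positive because f exceeds f(0) somewhere on the
half axis (`IsConvolvedNoise.ae_exists_lt`): the autocorrelation R tends to 0, and a Gaussian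
sequence with nearly decorrelated subsequences is unbounded above.

Uniqueness (`IsConvolvedNoise.ae_unique_max`). Regress every slope on X = f(u e₁): it becomes an
affine function of X, with coefficient proportional to its covariance with X and remainder
independent of X. Suprema over two families with coefficients separated by a gap agree for at most
one value of X, and X has no atoms. Two maximizers would thus have equal covariances with f(u e₁)
for all rational u, hence for all u. The set where R is maximal would then be stable under a nonzero
translation, contradicting R → 0 < R(0). -/

open Topology

/-! ### Differentiating a supremum with a unique maximizer. -/

section Danskin

variable {S E : Type*} [TopologicalSpace S]

/-- Outside a neighbourhood of the unique maximizer, a coercive family stays away from its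
maximum, locally uniformly in the parameter. -/
theorem exists_lt_eventually_forall_le_of_unique_max [TopologicalSpace E] {F : S → E → ℝ} {T : S}
    {x₀ : E} {K : Set S} {m : ℝ} (hF : Continuous (Function.uncurry F)) (hmax : ∀ t, t ≠ T → F t x₀ < F T x₀)
    (hK : IsCompact K) (hm : m < F T x₀) (hKm : ∀ᶠ z in 𝓝 x₀, ∀ t ∉ K, F t z ≤ m)
    {U : Set S} (hU : IsOpen U) (hT : T ∈ U) :
    ∃ m' < F T x₀, ∀ᶠ z in 𝓝 x₀, ∀ t ∉ U, F t z ≤ m' := by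
  have hF0 : Continuous fun t => F t x₀ := hF.comp (by fun_prop : Continuous fun t => (t, x₀))
  -- The maximum over the compact set `K \ U` is not at `T`. Taking `m₁` strictly above it leaves
  -- the room needed to move the parameter.
  obtain ⟨m₁, hm₁, hlt⟩ : ∃ m₁ < F T x₀, ∀ t ∈ K \ U, F t x₀ < m₁ := by
    rcases (K \ U).eq_empty_or_nonempty with h | h
    · exact ⟨m, hm, by simp [h]⟩
    · obtain ⟨s, hs, hsmax⟩ := (hK.diff hU).exists_isMaxOn h hF0.continuousOn
      have hsT : s ≠ T := fun h => hs.2 (h ▸ hT)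
      obtain ⟨m₁, h1, h2⟩ := exists_between (hmax s hsT)
      exact ⟨m₁, h2, fun t ht => (hsmax ht).trans_lt h1⟩
  have hev : ∀ᶠ z in 𝓝 x₀, ∀ t ∈ K \ U, F t z < m₁ := by
    refine (hK.diff hU).eventually_forall_of_forall_eventually fun t ht => ?_
    have hc : Continuous fun p : E × S => F p.2 p.1 :=
      hF.comp (by fun_prop : Continuous fun p : E × S => (p.2, p.1))
    exact hc.continuousAt.eventually_lt continuousAt_const (hlt t ht)
  refine ⟨max m m₁, max_lt hm hm₁, ?_⟩
  filter_upwards [hKm, hev] with z h1 h2 t ht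
  by_cases htK : t ∈ K
  · exact (h2 t ⟨htK, ht⟩).le.trans (le_max_right _ _)
  · exact (h1 t htK).trans (le_max_left _ _)

/-- **Danskin's theorem** with a unique maximizer. -/
theorem hasFDerivAt_iSup_of_unique_max [NormedAddCommGroup E] [NormedSpace ℝ E]
    {F : S → E → ℝ} {F' : S → E → E →L[ℝ] ℝ} {T : S} {x₀ : E}
    {K : Set S} {m : ℝ} (hF : Continuous (Function.uncurry F))
    (hF' : Continuous (Function.uncurry F')) (hd : ∀ t z, HasFDerivAt (F t) (F' t z) z)
    (hmax : ∀ t, t ≠ T → F t x₀ < F T x₀)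
    (hK : IsCompact K) (hm : m < F T x₀) (hKm : ∀ᶠ z in 𝓝 x₀, ∀ t ∉ K, F t z ≤ m)
    (hbdd : ∀ z, BddAbove (Set.range fun t => F t z)) :
    HasFDerivAt (fun z => ⨆ t, F t z) (F' T x₀) x₀ := by
  have hle : ∀ t, F t x₀ ≤ F T x₀ := fun t => by
    by_cases h : t = T
    · rw [h]
    · exact (hmax t h).le
  have : Nonempty S := ⟨T⟩
  have hsup : ⨆ t, F t x₀ = F T x₀ := le_antisymm (ciSup_le hle) (le_ciSup (hbdd x₀) T)
  rw [hasFDerivAt_iff_isLittleO, Asymptotics.isLittleO_iff]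
  intro ε hε
  have hnear : ∀ᶠ p : S × E in 𝓝 (T, x₀), ‖F' p.1 p.2 - F' T x₀‖ < ε / 2 := by
    have : Continuous fun p : S × E => ‖F' p.1 p.2 - F' T x₀‖ :=
      (hF'.sub continuous_const).norm
    refine this.continuousAt.eventually_lt continuousAt_const ?_
    simpa using hε
  rw [nhds_prod_eq] at hnear
  obtain ⟨U, hU, V, hV, hUV⟩ := (eventually_prod_iff.1 hnear)
  obtain ⟨U', hU'U, hU'o, hTU'⟩ := eventually_nhds_iff.1 hU
  obtain ⟨δ, hδ, hball⟩ := Metric.eventually_nhds_iff_ball.1 hV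
  obtain ⟨m', hm', hfar⟩ := exists_lt_eventually_forall_le_of_unique_max hF hmax hK hm hKm hU'o hTU'
  have hlow := (hasFDerivAt_iff_isLittleO.1 (hd T x₀)).def hε
  -- Indices outside `U'` are bounded by `m'`, so near `x₀` they cannot violate the upper estimate.
  have hsmall : ∀ᶠ z in 𝓝 x₀, m' < F T x₀ + F' T x₀ (z - x₀) - ε * ‖z - x₀‖ := by
    have : Continuous fun z => F T x₀ + F' T x₀ (z - x₀) - ε * ‖z - x₀‖ := by fun_prop
    refine continuousAt_const.eventually_lt this.continuousAt ?_
    simpa using hm'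
  filter_upwards [hfar, hlow, Metric.ball_mem_nhds x₀ hδ, hsmall] with z hzfar hzlow hzball hzsm
  rw [hsup, Real.norm_eq_abs, abs_le]
  have hεz : 0 ≤ ε * ‖z - x₀‖ := by positivity
  constructor
  · have h1 := le_ciSup (hbdd z) T
    rw [Real.norm_eq_abs, abs_le] at hzlow
    linarith [hzlow.1]
  · suffices ⨆ t, F t z ≤ F T x₀ + F' T x₀ (z - x₀) + ε * ‖z - x₀‖ by linarith
    refine ciSup_le fun t => ?_
    by_cases ht : t ∈ U'
    -- For `t` near `T`, the mean value inequality compares the increment of `F t` with the linear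
    -- map of `T`, uniformly in `t`; then `F t x₀ ≤ F T x₀` is used.
    · have hmv := (convex_ball x₀ δ).norm_image_sub_le_of_norm_hasFDerivWithin_le'
        (f := F t) (f' := F' t) (φ := F' T x₀) (C := ε)
        (fun y _ => (hd t y).hasFDerivWithinAt)
        (fun y hy => (hUV (hU'U t ht) (hball y hy)).le.trans (by linarith))
        (Metric.mem_ball_self hδ) hzball
      rw [Real.norm_eq_abs, abs_le] at hmv
      linarith [hmv.2, hle t]
    · linarith [hzfar t ht]

end Danskin

/-! ### Regularity of the slopes in time and space. -/

section Tau

variable {F : Type*} [NormedAddCommGroup F] [NormedSpace ℝ F]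

theorem tau_of_pos {g : Plane → F} {t : ℝ} (ht : 0 < t) (z : Plane) :
    tau g t z = t⁻¹ • (g (z + t • unitVec 0) - g z) := if_pos ht

theorem tau_zero (g : Plane → F) (z : Plane) : tau g 0 z = fderiv ℝ g z (unitVec 0) :=
  if_neg (lt_irrefl 0)

/-- The slope of a `C¹` function is an average of directional derivatives. -/
theorem tau_eq_integral [CompleteSpace F] {g : Plane → F} (hg : ContDiff ℝ 1 g) {t : ℝ}
    (ht : 0 ≤ t) (z : Plane) :
    tau g t z = ∫ s in (0 : ℝ)..1, fderiv ℝ g (z + (s * t) • unitVec 0) (unitVec 0) := by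
  rcases ht.eq_or_lt with rfl | ht
  · simp [tau_zero]
  · have hd : ∀ s ∈ Set.uIcc (0 : ℝ) 1, HasDerivAt (fun s : ℝ => g (z + (s * t) • unitVec 0))
        (t • fderiv ℝ g (z + (s * t) • unitVec 0) (unitVec 0)) s := by
      intro s _
      have h1 : HasDerivAt (fun s : ℝ => z + (s * t) • unitVec 0) (t • unitVec 0) s := by
        simpa using (((hasDerivAt_id s).mul_const t).smul_const (unitVec 0)).const_add z
      have h2 := ((hg.differentiable one_ne_zero) (z + (s * t) • unitVec 0)).hasFDerivAt
      simpa [map_smul, Function.comp_def] using h2.comp_hasDerivAt s h1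
    have hcont : Continuous fun s : ℝ =>
        t • fderiv ℝ g (z + (s * t) • unitVec 0) (unitVec 0) := by
      have := hg.continuous_fderiv one_ne_zero
      fun_prop
    have := intervalIntegral.integral_eq_sub_of_hasDerivAt hd (hcont.intervalIntegrable _ _)
    rw [intervalIntegral.integral_smul] at this
    rw [one_mul, zero_mul, zero_smul, add_zero] at this
    rw [tau_of_pos ht, ← this, smul_smul, inv_mul_cancel₀ ht.ne', one_smul]

/-- The integral formula absorbs the case distinction at `t = 0`, so joint continuity follows from
that of the derivative. -/
theorem continuous_tau [CompleteSpace F] {g : Plane → F} (hg : ContDiff ℝ 1 g) :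
    Continuous fun p : Set.Ici (0 : ℝ) × Plane => tau g p.1 p.2 := by
  have h : (fun p : Set.Ici (0 : ℝ) × Plane => tau g p.1 p.2) = fun p =>
      ∫ s in (0 : ℝ)..1, fderiv ℝ g (p.2 + (s * (p.1 : ℝ)) • unitVec 0) (unitVec 0) :=
    funext fun p => tau_eq_integral hg p.1.2 p.2
  rw [h]
  apply intervalIntegral.continuous_parametric_intervalIntegral_of_continuous'
  have := hg.continuous_fderiv one_ne_zero
  unfold Function.uncurry
  fun_prop

/-- Differentiation in space commutes with taking slopes. -/
theorem hasFDerivAt_tau {g : Plane → ℝ} (hg : ContDiff ℝ 2 g) {t : ℝ} (ht : 0 ≤ t) (z : Plane) :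
    HasFDerivAt (tau g t) (tau (fderiv ℝ g) t z) z := by
  have hdiff : Differentiable ℝ g := hg.differentiable two_ne_zero
  rcases ht.eq_or_lt with rfl | ht
  · have h1 : ContDiff ℝ 1 (fderiv ℝ g) := hg.fderiv_right (by norm_num)
    have h2 := ((h1.differentiable one_ne_zero z).hasFDerivAt).clm_apply
      (hasFDerivAt_const (unitVec 0) z)
    -- At `t = 0` the claim is that derivatives in the directions `v` and e₁ commute.
    have hsymm : IsSymmSndFDerivAt ℝ g z :=
      hg.contDiffAt.isSymmSndFDerivAt (by simp)
    have h3 : tau g 0 = fun y => fderiv ℝ g y (unitVec 0) := funext fun y => tau_zero g y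
    rw [h3, tau_zero]
    refine h2.congr_fderiv ?_
    ext v
    simpa using hsymm.eq v (unitVec 0)
  · have h3 : tau g t = fun y => t⁻¹ • (g (y + t • unitVec 0) - g y) :=
      funext fun y => tau_of_pos ht y
    rw [h3, tau_of_pos ht]
    have h4 : HasFDerivAt (fun y => g (y + t • unitVec 0)) (fderiv ℝ g (z + t • unitVec 0)) z :=
      (hasFDerivAt_comp_add_right _).2 (hdiff _).hasFDerivAt
    exact (h4.sub (hdiff z).hasFDerivAt).const_smul t⁻¹

theorem toDual_tau_gradient {g : Plane → ℝ} (hg : ContDiff ℝ 2 g) (t : ℝ) (z : Plane) :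
    InnerProductSpace.toDual ℝ Plane (tau (∇ g) t z) = tau (fderiv ℝ g) t z := by
  have h : ∀ y, InnerProductSpace.toDual ℝ Plane (∇ g y) = fderiv ℝ g y := fun y => by
    simp [gradient]
  unfold tau
  split_ifs
  · rw [map_smul, map_sub, h, h]
  · have h1 : ContDiff ℝ 1 (fderiv ℝ g) := hg.fderiv_right (by norm_num)
    have h2 : ∇ g = fun y =>
        (InnerProductSpace.toDual ℝ Plane).symm.toContinuousLinearEquiv (fderiv ℝ g y) := rfl
    have h3 := ((InnerProductSpace.toDual ℝ Plane).symm.toContinuousLinearEquiv.hasFDerivAt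
      (x := fderiv ℝ g z)).comp z (h1.differentiable one_ne_zero z).hasFDerivAt
    have h4 : fderiv ℝ (∇ g) z = _ := h3.fderiv
    rw [h4]
    simp
end Tau

/-! ### Coercivity of the slopes and differentiability, for a deterministic function. -/

section SlopeField

@[simp]
theorem norm_unitVec (i : Fin 2) : ‖unitVec i‖ = 1 := by simp [unitVec]

/-- Growth of order `√n` along the first axis, uniformly over bounded sets. -/
def HasSqrtGrowth (g : Plane → ℝ) : Prop :=
  ∀ R : ℕ, ∀ᶠ n : ℕ in atTop, ∀ z : Plane, ‖z‖ ≤ R → |g (z + (n : ℝ) • unitVec 0)| ≤ √n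

/-- The fractional part of `t` is absorbed into the base point, which costs one unit of radius. -/
theorem HasSqrtGrowth.eventually_abs_le {g : Plane → ℝ} (hg : HasSqrtGrowth g) (R : ℕ) :
    ∀ᶠ t : ℝ in atTop, ∀ z : Plane, ‖z‖ ≤ R → |g (z + t • unitVec 0)| ≤ √t := by
  filter_upwards [tendsto_nat_floor_atTop.eventually (hg (R + 1)), eventually_ge_atTop 0]
    with t ht ht0 z hz
  have hfl : (⌊t⌋₊ : ℝ) ≤ t := Nat.floor_le ht0
  have h := ht (z + (t - ⌊t⌋₊) • unitVec 0) ?_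
  · rw [add_assoc, ← add_smul, sub_add_cancel] at h
    exact h.trans (Real.sqrt_le_sqrt hfl)
  · push_cast
    refine (norm_add_le _ _).trans (add_le_add hz ?_)
    rw [norm_smul, norm_unitVec, mul_one, Real.norm_eq_abs, abs_le]
    constructor <;> linarith [Nat.lt_floor_add_one t]

theorem HasSqrtGrowth.eventually_tau_le {g : Plane → ℝ} (hg : HasSqrtGrowth g)
    (hc : Continuous g) (R : ℕ) {m : ℝ} (hm : 0 < m) :
    ∀ᶠ t : ℝ in atTop, ∀ z : Plane, ‖z‖ ≤ R → tau g t z ≤ m := by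
  obtain ⟨C, hC⟩ := (isCompact_closedBall (0 : Plane) R).exists_bound_of_continuousOn
    hc.continuousOn
  -- Multiplying |C| ≤ m√t − 1 by √t ≥ 1 yields √t + |C| ≤ m t, which bounds the increment.
  have hlim : Tendsto (fun t : ℝ => m * √t - 1) atTop atTop :=
    tendsto_atTop_add_const_right _ _ (Real.tendsto_sqrt_atTop.const_mul_atTop hm)
  filter_upwards [hg.eventually_abs_le R, eventually_ge_atTop 1,
    hlim.eventually_ge_atTop (|C|)] with t h1 h2 h3 z hz
  have ht : 0 < t := by linarith
  rw [tau_of_pos ht, smul_eq_mul, inv_mul_le_iff₀ ht]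
  have h4 := (le_abs_self _).trans (h1 z hz)
  have h5 := (neg_le_abs _).trans ((hC z (by simpa using hz)).trans (le_abs_self C))
  have h6 : 1 ≤ √t := Real.one_le_sqrt.2 h2
  have h7 : √t * √t = t := Real.mul_self_sqrt ht.le
  have h8 : |C| * √t ≥ |C| := le_mul_of_one_le_right (abs_nonneg _) h6
  nlinarith [mul_le_mul_of_nonneg_left h3 (zero_le_one.trans h6)]

theorem isCompact_setOf_coe_le (t₀ : ℝ) : IsCompact {t : Set.Ici (0 : ℝ) | (t : ℝ) ≤ t₀} := by
  have : IsCompact ((↑) ⁻¹' Set.Iic t₀ : Set (Set.Ici (0 : ℝ))) := by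
    refine Subtype.isCompact_iff.2 ?_
    rw [Subtype.image_preimage_coe, Set.Ici_inter_Iic]
    exact isCompact_Icc
  exact this

theorem HasSqrtGrowth.bddAbove_tau {g : Plane → ℝ} (hg : HasSqrtGrowth g)
    (hc : ContDiff ℝ 1 g) (z : Plane) :
    BddAbove (Set.range fun t : Set.Ici (0 : ℝ) => tau g t z) := by
  obtain ⟨R, hR⟩ := exists_nat_ge ‖z‖
  obtain ⟨t₀, ht₀⟩ := eventually_atTop.1 (hg.eventually_tau_le hc.continuous R one_pos)
  have hcont : Continuous fun t : Set.Ici (0 : ℝ) => tau g t z :=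
    (continuous_tau hc).comp (by fun_prop : Continuous fun t : Set.Ici (0 : ℝ) => (t, z))
  obtain ⟨M, hM⟩ := ((isCompact_setOf_coe_le t₀).image hcont).bddAbove
  refine ⟨max M 1, ?_⟩
  rintro _ ⟨t, rfl⟩
  rcases le_total (t : ℝ) t₀ with h | h
  · exact (hM ⟨t, h, rfl⟩).trans (le_max_left _ _)
  · exact (ht₀ t h z hR).trans (le_max_right _ _)

theorem tau_pos_of_lt {g : Plane → ℝ} {s : ℝ} (hs : 0 < s) (hpos : g 0 < g (s • unitVec 0)) :
    0 < tau g s 0 := by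
  rw [tau_of_pos hs, zero_add]
  exact mul_pos (inv_pos.2 hs) (sub_pos.2 hpos)

/-- Growth controls late slopes only by positive levels; the positive slope at `s` serves as such a
level and confines the search to a compact interval. -/
theorem HasSqrtGrowth.exists_forall_tau_le {g : Plane → ℝ} (hg : HasSqrtGrowth g)
    (hc : ContDiff ℝ 1 g) {s : ℝ} (hs : 0 < s) (hpos : g 0 < g (s • unitVec 0)) :
    ∃ T : ℝ, 0 ≤ T ∧ ∀ t : ℝ, 0 ≤ t → tau g t 0 ≤ tau g T 0 := by
  have hτ := tau_pos_of_lt hs hpos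
  obtain ⟨t₀, ht₀⟩ := eventually_atTop.1 (hg.eventually_tau_le hc.continuous 0 hτ)
  have hcont : Continuous fun t : Set.Ici (0 : ℝ) => tau g t 0 :=
    (continuous_tau hc).comp (by fun_prop : Continuous fun t : Set.Ici (0 : ℝ) => (t, (0 : Plane)))
  obtain ⟨T, hT, hmax⟩ := (isCompact_setOf_coe_le (max t₀ s)).exists_isMaxOn
    ⟨⟨s, hs.le⟩, le_max_right t₀ s⟩ hcont.continuousOn
  refine ⟨T, T.2, fun t ht => ?_⟩
  rcases le_total t (max t₀ s) with h | h
  · exact hmax (a := ⟨t, ht⟩) h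
  · have h1 : tau g s 0 ≤ tau g T 0 := hmax (a := ⟨s, hs.le⟩) (le_max_right t₀ s)
    exact (ht₀ t ((le_max_left _ _).trans h) 0 (by simp)).trans h1

theorem slopeField_eq_of_forall_tau_le {g : Plane → ℝ} {T : ℝ} (hT : 0 ≤ T)
    (hmax : ∀ t : ℝ, 0 ≤ t → tau g t 0 ≤ tau g T 0) : slopeField g 0 = tau g T 0 := by
  have : Nonempty (Set.Ici (0 : ℝ)) := ⟨⟨0, Set.self_mem_Ici⟩⟩
  refine le_antisymm (ciSup_le fun t => hmax t t.2) ?_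
  exact le_ciSup (f := fun t : Set.Ici (0 : ℝ) => tau g t 0)
    ⟨tau g T 0, by rintro _ ⟨t, rfl⟩; exact hmax t t.2⟩ ⟨T, hT⟩

/-- Danskin's theorem applies with half the positive maximum as the level under which late slopes
stay, for all z in the unit ball. -/
theorem HasSqrtGrowth.hasGradientAt_slopeField {g : Plane → ℝ} (hg : HasSqrtGrowth g)
    (hc : ContDiff ℝ 2 g) {s : ℝ} (hs : 0 < s) (hpos : g 0 < g (s • unitVec 0)) {T : ℝ}
    (hT : 0 ≤ T) (hmax : ∀ t : ℝ, 0 ≤ t → tau g t 0 ≤ tau g T 0)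
    (huniq : ∀ t : ℝ, 0 ≤ t → tau g t 0 = tau g T 0 → t = T) :
    HasGradientAt (slopeField g) (tau (∇ g) T 0) 0 := by
  have hτ : 0 < tau g T 0 := (tau_pos_of_lt hs hpos).trans_le (hmax s hs.le)
  have hc1 : ContDiff ℝ 1 g := hc.of_le (by norm_num)
  obtain ⟨t₀, ht₀⟩ := eventually_atTop.1 (hg.eventually_tau_le hc.continuous 1 (half_pos hτ))
  rw [hasGradientAt_iff_hasFDerivAt, toDual_tau_gradient hc]
  refine hasFDerivAt_iSup_of_unique_max (S := Set.Ici (0 : ℝ)) (F := fun t z => tau g t z)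
    (F' := fun t z => tau (fderiv ℝ g) t z) (T := ⟨T, hT⟩) (m := tau g T 0 / 2)
    (continuous_tau hc1) (continuous_tau (hc.fderiv_right (by norm_num)))
    (fun t z => hasFDerivAt_tau hc t.2 z)
    (fun t ht => (hmax t t.2).lt_of_ne fun h => ht (Subtype.ext (huniq t t.2 h)))
    (isCompact_setOf_coe_le t₀) (half_lt_self hτ) ?_ (fun z => hg.bddAbove_tau hc1 z)
  filter_upwards [Metric.closedBall_mem_nhds (0 : Plane) one_pos] with z hz t ht
  exact ht₀ t (not_le.1 ht).le z (by simpa using hz)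

end SlopeField

/-! ### The autocorrelation of the kernel, and separation of slopes by covariances. -/

section Kernel

/-- The autocorrelation of `q` along the first axis. -/
noncomputable def axisCorr (q : Plane → ℝ) (u : ℝ) : ℝ := ∫ x, q x * q (x - u • unitVec 0)

/-- The derivative of the autocorrelation of `q` along the first axis. -/
noncomputable def axisCorrDeriv (q : Plane → ℝ) (u : ℝ) : ℝ :=
  ∫ x, q x * (-partialDeriv 0 q (x - u • unitVec 0))

theorem inner_translateL2 {q : Plane → ℝ} (hq : MemLp q 2 (volume : Measure Plane)) (z w : Plane) :
    inner ℝ (translateL2 hq z) (translateL2 hq w) = ∫ x, q x * q (x - (w - z)) := by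
  rw [L2.inner_def, ← integral_sub_right_eq_self (fun x => q x * q (x - (w - z))) z]
  refine integral_congr_ae ?_
  filter_upwards [(hq.comp_measurePreserving (measurePreserving_sub_right volume z)).coeFn_toLp,
    (hq.comp_measurePreserving (measurePreserving_sub_right volume w)).coeFn_toLp] with x hx hy
  simp only [translateL2]
  erw [hx, hy]
  simp [mul_comm]

theorem inner_translateL2_axis {q : Plane → ℝ} (hq : MemLp q 2 (volume : Measure Plane))
    (s t : ℝ) : inner ℝ (translateL2 hq (s • unitVec 0)) (translateL2 hq (t • unitVec 0))
      = axisCorr q (t - s) := by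
  rw [inner_translateL2, ← sub_smul, axisCorr]

theorem axisCorr_neg {q : Plane → ℝ} (hq : MemLp q 2 (volume : Measure Plane)) (u : ℝ) :
    axisCorr q (-u) = axisCorr q u := by
  have h1 := inner_translateL2_axis hq 0 u
  have h2 := inner_translateL2_axis hq u 0
  rw [real_inner_comm, h1] at h2
  simpa using h2.symm

/-- Expand the squared L² distance between `q` and its translate. -/
theorem axisCorr_le {q : Plane → ℝ} (hq : MemLp q 2 (volume : Measure Plane)) (u : ℝ) :
    axisCorr q u ≤ axisCorr q 0 := by
  have h := norm_nonneg (translateL2 hq ((0 : ℝ) • unitVec 0) - translateL2 hq (u • unitVec 0))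
  have h2 := norm_sub_sq_real (translateL2 hq ((0 : ℝ) • unitVec 0)) (translateL2 hq (u • unitVec 0))
  rw [← real_inner_self_eq_norm_sq (translateL2 hq ((0 : ℝ) • unitVec 0)),
    ← real_inner_self_eq_norm_sq (translateL2 hq (u • unitVec 0)), inner_translateL2_axis,
    inner_translateL2_axis, inner_translateL2_axis, sub_self, sub_self, sub_zero] at h2
  nlinarith [sq_nonneg ‖translateL2 hq ((0 : ℝ) • unitVec 0) - translateL2 hq (u • unitVec 0)‖]

theorem exists_abs_le_of_decay {g : Plane → ℝ} (hg : Continuous g) {C β : ℝ} (hC : 0 < C)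
    (hβ : 0 ≤ β) (h : ∀ z : Plane, 1 ≤ ‖z‖ → |g z| ≤ C / ‖z‖ ^ β) : ∃ M, ∀ z, |g z| ≤ M := by
  obtain ⟨M, hM⟩ := (isCompact_closedBall (0 : Plane) 1).exists_bound_of_continuousOn hg.continuousOn
  refine ⟨max M C, fun z => ?_⟩
  rcases le_total ‖z‖ 1 with hz | hz
  · exact (hM z (by simpa using hz)).trans (le_max_left _ _)
  · exact ((h z hz).trans (div_le_self hC.le (Real.one_le_rpow hz hβ))).trans (le_max_right _ _)

namespace IsAdmissibleKernel

variable {q : Plane → ℝ}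

theorem exists_abs_le (hq : IsAdmissibleKernel q) : ∃ M, ∀ z, |q z| ≤ M := by
  obtain ⟨β, hβ, C, hC, h⟩ := hq.decay
  exact exists_abs_le_of_decay hq.contDiff.continuous hC (by linarith) (h 0 0 (by norm_num))

theorem continuous_partialDeriv (hq : IsAdmissibleKernel q) : Continuous (partialDeriv 0 q) :=
  (hq.contDiff.continuous_fderiv (by norm_num)).clm_apply continuous_const

theorem exists_abs_partialDeriv_le (hq : IsAdmissibleKernel q) :
    ∃ M, ∀ z, |partialDeriv 0 q z| ≤ M := by
  obtain ⟨β, hβ, C, hC, h⟩ := hq.decay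
  exact exists_abs_le_of_decay hq.continuous_partialDeriv hC (by linarith) (h 1 0 (by norm_num))

theorem integrable (hq : IsAdmissibleKernel q) : Integrable q := by
  obtain ⟨M, hM⟩ := hq.exists_abs_le
  obtain ⟨β, hβ, C, hC, h⟩ := hq.decay
  -- Integrability needs only β > 2, the dimension. The factor `2 ^ β` comes from 1 + ‖z‖ ≤ 2 in the
  -- unit ball and 1 + ‖z‖ ≤ 2‖z‖ outside.
  have hint : Integrable fun z : Plane => (max M C * 2 ^ β) * (1 + ‖z‖) ^ (-β) := by
    refine (integrable_one_add_norm ?_).const_mul _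
    rw [finrank_euclideanSpace_fin]
    push_cast
    linarith
  refine hint.mono' hq.contDiff.continuous.aestronglyMeasurable (ae_of_all _ fun z => ?_)
  have hpos : 0 < 1 + ‖z‖ := by positivity
  rw [Real.norm_eq_abs, Real.rpow_neg hpos.le, ← div_eq_mul_inv, le_div_iff₀ (by positivity)]
  rcases le_total ‖z‖ 1 with hz | hz
  · gcongr
    · exact (hM z).trans (le_max_left _ _)
    · linarith
  · have hz0 : 0 < ‖z‖ := by linarith
    have h1 : (1 + ‖z‖) ^ β ≤ 2 ^ β * ‖z‖ ^ β := by
      rw [← Real.mul_rpow (by norm_num) hz0.le]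
      exact Real.rpow_le_rpow hpos.le (by linarith) (by linarith)
    calc |q z| * (1 + ‖z‖) ^ β ≤ (C / ‖z‖ ^ β) * (2 ^ β * ‖z‖ ^ β) := by
          gcongr
          exact h 0 0 (by norm_num) z hz
      _ = C * 2 ^ β := by field_simp
      _ ≤ _ := by gcongr; exact le_max_right _ _

/-- Evenness identifies the convolution at 0 with the squared L² norm of `q`, the variance of the
field. -/
theorem axisCorr_zero_pos (hq : IsAdmissibleKernel q) : 0 < axisCorr q 0 := by
  have h := hq.convolution_pos
  rw [convolution_def] at h
  simpa [axisCorr, ← hq.even] using h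

theorem hasDerivAt_axisCorr (hq : IsAdmissibleKernel q) (u : ℝ) :
    HasDerivAt (axisCorr q) (axisCorrDeriv q u) u := by
  obtain ⟨M, hM⟩ := hq.exists_abs_le
  obtain ⟨M', hM'⟩ := hq.exists_abs_partialDeriv_le
  have hqc := hq.contDiff.continuous
  have hpc := hq.continuous_partialDeriv
  refine (hasDerivAt_integral_of_dominated_loc_of_deriv_le (bound := fun x => |q x| * M')
    (F' := fun u x => q x * (-partialDeriv 0 q (x - u • unitVec 0)))
    (Metric.ball_mem_nhds u one_pos) ?_ ?_ ?_ ?_ ?_ ?_).2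
  · exact Eventually.of_forall fun v =>
      (by fun_prop : Continuous fun x => q x * q (x - v • unitVec 0)).aestronglyMeasurable
  · exact hq.integrable.mul_bdd (c := M)
      (by fun_prop : Continuous fun x => q (x - u • unitVec 0)).aestronglyMeasurable
      (ae_of_all _ fun x => hM _)
  · exact (by fun_prop : Continuous fun x =>
      q x * (-partialDeriv 0 q (x - u • unitVec 0))).aestronglyMeasurable
  · refine ae_of_all _ fun x v _ => ?_
    rw [norm_mul, norm_neg, Real.norm_eq_abs, Real.norm_eq_abs]
    exact mul_le_mul_of_nonneg_left (hM' _) (abs_nonneg _)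
  · exact hq.integrable.abs.mul_const _
  · refine ae_of_all _ fun x v _ => ?_
    have h1 : HasDerivAt (fun v : ℝ => x - v • unitVec 0) (-unitVec 0) v := by
      simpa using ((hasDerivAt_id v).smul_const (unitVec 0)).const_sub x
    have h2 := (hq.contDiff.differentiable (by norm_num) (x - v • unitVec 0)).hasFDerivAt
    have h3 := (h2.comp_hasDerivAt v h1).const_mul (q x)
    simpa [partialDeriv, Function.comp_def] using h3

theorem continuous_axisCorr (hq : IsAdmissibleKernel q) : Continuous (axisCorr q) :=
  continuous_iff_continuousAt.2 fun u => (hq.hasDerivAt_axisCorr u).continuousAt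

theorem continuous_axisCorrDeriv (hq : IsAdmissibleKernel q) : Continuous (axisCorrDeriv q) := by
  obtain ⟨M', hM'⟩ := hq.exists_abs_partialDeriv_le
  have hqc := hq.contDiff.continuous
  have hpc := hq.continuous_partialDeriv
  refine continuous_of_dominated (bound := fun x => |q x| * M') ?_ ?_ ?_ ?_
  · exact fun u => (by fun_prop : Continuous fun x =>
      q x * (-partialDeriv 0 q (x - u • unitVec 0))).aestronglyMeasurable
  · refine fun v => ae_of_all _ fun x => ?_
    rw [norm_mul, norm_neg, Real.norm_eq_abs, Real.norm_eq_abs]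
    exact mul_le_mul_of_nonneg_left (hM' _) (abs_nonneg _)
  · exact hq.integrable.abs.mul_const _
  · exact ae_of_all _ fun x => by fun_prop

theorem tendsto_axisCorr (hq : IsAdmissibleKernel q) : Tendsto (axisCorr q) atTop (𝓝 0) := by
  obtain ⟨M, hM⟩ := hq.exists_abs_le
  obtain ⟨β, hβ, C, hC, h⟩ := hq.decay
  have hqc := hq.contDiff.continuous
  have h0 : (0 : ℝ) = ∫ x : Plane, (0 : ℝ) := by simp
  rw [h0]
  refine tendsto_integral_filter_of_dominated_convergence (fun x => |q x| * M) ?_ ?_ ?_ ?_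
  · exact Eventually.of_forall fun v =>
      (by fun_prop : Continuous fun x => q x * q (x - v • unitVec 0)).aestronglyMeasurable
  · refine Eventually.of_forall fun v => ae_of_all _ fun x => ?_
    rw [norm_mul, Real.norm_eq_abs, Real.norm_eq_abs]
    exact mul_le_mul_of_nonneg_left (hM _) (abs_nonneg _)
  · exact hq.integrable.abs.mul_const _
  · refine ae_of_all _ fun x => ?_
    have hn : Tendsto (fun v : ℝ => ‖x - v • unitVec 0‖) atTop atTop := by
      refine tendsto_atTop_mono (fun v => ?_) (tendsto_atTop_add_const_right atTop (-‖x‖) tendsto_id)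
      have := norm_sub_norm_le (v • unitVec 0) x
      rw [norm_smul, norm_unitVec, mul_one, norm_sub_rev] at this
      have h2 := le_abs_self v
      rw [← Real.norm_eq_abs] at h2
      simp only [id]
      linarith
    have h1 : Tendsto (fun v : ℝ => C / ‖x - v • unitVec 0‖ ^ β) atTop (𝓝 0) :=
      ((tendsto_rpow_atTop (by linarith : 0 < β)).comp hn).const_div_atTop C
    have h2 : Tendsto (fun v : ℝ => q (x - v • unitVec 0)) atTop (𝓝 0) := by
      refine squeeze_zero_norm' ?_ h1
      filter_upwards [hn.eventually_ge_atTop 1] with v hv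
      exact h 0 0 (by norm_num) _ hv
    simpa using h2.const_mul (q x)

/-- The set where the autocorrelation is maximal is not stable under a translation. -/
theorem not_forall_axisCorr_add_eq (hq : IsAdmissibleKernel q) {s : ℝ} (hs : 0 < s) :
    ¬ ∀ v, axisCorr q v = axisCorr q 0 → axisCorr q (v + s) = axisCorr q 0 := by
  intro h
  have hn : ∀ n : ℕ, axisCorr q (n * s) = axisCorr q 0 := by
    intro n
    induction n with
    | zero => simp
    | succ n ih => rw [← h _ ih]; push_cast; ring_nf
  have h1 : Tendsto (fun n : ℕ => axisCorr q (n * s)) atTop (𝓝 0) :=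
    hq.tendsto_axisCorr.comp (tendsto_natCast_atTop_atTop.atTop_mul_const hs)
  simp_rw [hn] at h1
  exact hq.axisCorr_zero_pos.ne' (tendsto_nhds_unique tendsto_const_nhds h1)

end IsAdmissibleKernel

/-- The covariance of the slope `τ_f(t, 0)` and of `f(u e₁)`. -/
noncomputable def slopeCov (q : Plane → ℝ) (u t : ℝ) : ℝ :=
  if 0 < t then t⁻¹ * (axisCorr q (u - t) - axisCorr q u) else -axisCorrDeriv q u

theorem slopeCov_of_pos {q : Plane → ℝ} {t : ℝ} (ht : 0 < t) (u : ℝ) :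
    slopeCov q u t = t⁻¹ * (axisCorr q (u - t) - axisCorr q u) := if_pos ht

theorem slopeCov_zero {q : Plane → ℝ} (u : ℝ) : slopeCov q u 0 = -axisCorrDeriv q u :=
  if_neg (lt_irrefl 0)

namespace IsAdmissibleKernel

variable {q : Plane → ℝ}

theorem continuous_slopeCov_left (hq : IsAdmissibleKernel q) (t : ℝ) :
    Continuous fun u => slopeCov q u t := by
  have h1 := hq.continuous_axisCorr
  have h2 := hq.continuous_axisCorrDeriv
  unfold slopeCov
  split_ifs <;> fun_prop

/-- Right limits suffice, since maximizers, 0 included, are approached by positive rational times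
from the right. -/
theorem tendsto_slopeCov (hq : IsAdmissibleKernel q) (u : ℝ) {t : ℝ} (ht : 0 ≤ t) :
    Tendsto (slopeCov q u) (𝓝[>] t) (𝓝 (slopeCov q u t)) := by
  have h1 := hq.continuous_axisCorr
  rcases ht.eq_or_lt with rfl | ht
  · have hd := hq.hasDerivAt_axisCorr u
    have hd' : HasDerivAt (fun t => axisCorr q (u - t)) (-axisCorrDeriv q u) 0 := by
      have : HasDerivAt (axisCorr q) (axisCorrDeriv q u) (u - 0) := by simpa using hd
      simpa [Function.comp_def] using this.comp (0 : ℝ) ((hasDerivAt_id (0 : ℝ)).const_sub u)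
    have h3 := hd'.tendsto_slope_zero_right
    rw [slopeCov_zero]
    refine h3.congr' ?_
    filter_upwards [self_mem_nhdsWithin] with t ht
    rw [slopeCov_of_pos ht]
    simp
  · have h3 : ContinuousAt (fun t => t⁻¹ * (axisCorr q (u - t) - axisCorr q u)) t := by
      have := ht.ne'
      fun_prop (disch := assumption)
    rw [slopeCov_of_pos ht]
    refine (h3.tendsto.mono_left nhdsWithin_le_nhds).congr' ?_
    filter_upwards [self_mem_nhdsWithin] with s hs
    rw [slopeCov_of_pos (ht.trans hs)]

/-- The covariances with the field separate the slopes. -/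
theorem exists_rat_slopeCov_ne (hq : IsAdmissibleKernel q) {s t : ℝ} (hs : 0 ≤ s) (hst : s < t) :
    ∃ u : ℚ, slopeCov q u s ≠ slopeCov q u t := by
  by_contra! hcon
  have hall : ∀ u, slopeCov q u s = slopeCov q u t := by
    have := Rat.isDenseEmbedding_coe_real.dense.equalizer (hq.continuous_slopeCov_left s)
      (hq.continuous_slopeCov_left t) (funext hcon)
    exact fun u => congrFun this u
  have ht : 0 < t := hs.trans_lt hst
  have hle := axisCorr_le hq.memLp_self
  rcases hs.eq_or_lt with rfl | hs
  -- At a maximum point of R the derivative vanishes, so equality of the covariances forces R to be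
  -- maximal again after a shift by `t`.
  · refine hq.not_forall_axisCorr_add_eq ht fun v hv => ?_
    have h1 := hall (-v)
    rw [slopeCov_zero, slopeCov_of_pos ht] at h1
    have hv' : axisCorr q (-v) = axisCorr q 0 := by rw [axisCorr_neg hq.memLp_self, hv]
    have h2 : axisCorrDeriv q (-v) = 0 := by
      have hmax : IsLocalMax (axisCorr q) (-v) := Eventually.of_forall fun w => by
        rw [hv']; exact hle w
      exact hmax.hasDerivAt_eq_zero (hq.hasDerivAt_axisCorr _)
    rw [h2, neg_zero, eq_comm, mul_eq_zero, or_iff_right (inv_ne_zero ht.ne'), hv', sub_eq_zero] at h1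
    rw [← axisCorr_neg hq.memLp_self, ← h1]
    ring_nf
  -- With u = v + s, equality reads (R(0) − R(u))/s = (R(u − t) − R(u))/t ≤ (R(0) − R(u))/t; as s <
  -- t, this forces R(u) = R(0).
  · refine hq.not_forall_axisCorr_add_eq hs fun v hv => ?_
    have h1 := hall (v + s)
    rw [slopeCov_of_pos hs, slopeCov_of_pos ht, add_sub_cancel_right, hv] at h1
    field_simp at h1
    nlinarith [hle (v + s), hle (v + s - t)]

end IsAdmissibleKernel

end Kernel

/-! ### Gaussian computations and unboundedness of the field along the axis. -/

section WhiteNoise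

variable {Ω : Type*} [MeasurableSpace Ω] {P : Measure Ω}
  {W : Lp ℝ 2 (volume : Measure Plane) → Ω → ℝ}

namespace IsWhiteNoise

theorem aemeasurable (hW : IsWhiteNoise P W) (φ : Lp ℝ 2 (volume : Measure Plane)) :
    AEMeasurable (W φ) P := hW.isGaussianProcess.aemeasurable φ

theorem memLp_two (hW : IsWhiteNoise P W) (φ : Lp ℝ 2 (volume : Measure Plane)) :
    MemLp (W φ) 2 P := (hW.isGaussianProcess.hasGaussianLaw_eval φ).memLp_two

theorem integrable_mul (hW : IsWhiteNoise P W) (φ ψ : Lp ℝ 2 (volume : Measure Plane)) :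
    Integrable (fun ω => W φ ω * W ψ ω) P := (hW.memLp_two φ).integrable_mul (hW.memLp_two ψ)

/-- A white noise is almost surely linear on each pair. -/
theorem ae_eq_add_smul (hW : IsWhiteNoise P W) (c : ℝ) (φ ψ : Lp ℝ 2 (volume : Measure Plane)) :
    ∀ᵐ ω ∂P, W (φ + c • ψ) ω = W φ ω + c * W ψ ω := by
  set χ := φ + c • ψ with hχ
  have hm : MemLp (fun ω => W χ ω - W φ ω - c * W ψ ω) 2 P :=
    ((hW.memLp_two χ).sub (hW.memLp_two φ)).sub ((hW.memLp_two ψ).const_mul c)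
  -- The covariance is an inner product, so the second moment of the linearity defect vanishes.
  have h0 : ∫ ω, (W χ ω - W φ ω - c * W ψ ω) ^ 2 ∂P = 0 := by
    have h1 : (fun ω => (W χ ω - W φ ω - c * W ψ ω) ^ 2) = fun ω =>
        (W χ ω * W χ ω + W φ ω * W φ ω + c ^ 2 * (W ψ ω * W ψ ω)) -
        (2 * (W χ ω * W φ ω) + 2 * c * (W χ ω * W ψ ω) - 2 * c * (W φ ω * W ψ ω)) := by
      funext ω; ring
    have i := hW.integrable_mul
    rw [h1, integral_sub, integral_add, integral_add, integral_sub, integral_add]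
    · simp only [integral_const_mul, hW.covariance, hχ, inner_add_left, inner_add_right,
        real_inner_smul_left, real_inner_smul_right, real_inner_comm φ ψ]
      ring
    all_goals
      first
      | exact i _ _
      | exact (i _ _).const_mul _
      | exact (i _ _).add (i _ _)
      | exact ((i _ _).const_mul _).add ((i _ _).const_mul _)
      | exact ((i _ _).add (i _ _)).add ((i _ _).const_mul _)
      | exact (((i _ _).const_mul _).add ((i _ _).const_mul _)).sub ((i _ _).const_mul _)
  rw [integral_eq_zero_iff_of_nonneg (fun _ => sq_nonneg _) hm.integrable_sq] at h0
  filter_upwards [h0] with ω hω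
  have := pow_eq_zero_iff (two_ne_zero) |>.1 hω
  linarith

variable [IsProbabilityMeasure P]

theorem map_eq_gaussianReal (hW : IsWhiteNoise P W) (φ : Lp ℝ 2 (volume : Measure Plane)) :
    P.map (W φ) = gaussianReal 0 (inner ℝ φ φ : ℝ).toNNReal := by
  rw [(hW.isGaussianProcess.hasGaussianLaw_eval φ).map_eq_gaussianReal, hW.centered,
    variance_eq_sub (hW.memLp_two φ), hW.centered, ← hW.covariance φ φ]
  simp [pow_two]

theorem integral_exp (hW : IsWhiteNoise P W) (φ : Lp ℝ 2 (volume : Measure Plane)) (l : ℝ) :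
    ∫ ω, Real.exp (l * W φ ω) ∂P = Real.exp (inner ℝ φ φ * l ^ 2 / 2) := by
  have h := mgf_gaussianReal (hW.map_eq_gaussianReal φ) l
  rw [mgf] at h
  rw [h, Real.coe_toNNReal _ real_inner_self_nonneg, zero_mul, zero_add]

theorem integrable_exp (hW : IsWhiteNoise P W) (φ : Lp ℝ 2 (volume : Measure Plane)) (l : ℝ) :
    Integrable (fun ω => Real.exp (l * W φ ω)) P :=
  .of_integral_ne_zero (by rw [hW.integral_exp]; positivity)

theorem integrable_exp_mul_exp (hW : IsWhiteNoise P W) (φ ψ : Lp ℝ 2 (volume : Measure Plane))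
    (l : ℝ) : Integrable (fun ω => Real.exp (l * W φ ω) * Real.exp (l * W ψ ω)) P := by
  refine (hW.integrable_exp (φ + (1 : ℝ) • ψ) l).congr ?_
  filter_upwards [hW.ae_eq_add_smul 1 φ ψ] with ω hω
  rw [hω, ← Real.exp_add]
  ring_nf

theorem integral_exp_mul_exp (hW : IsWhiteNoise P W) (φ ψ : Lp ℝ 2 (volume : Measure Plane))
    (l : ℝ) : ∫ ω, Real.exp (l * W φ ω) * Real.exp (l * W ψ ω) ∂P
      = Real.exp ((inner ℝ φ φ + inner ℝ ψ ψ) * l ^ 2 / 2) * Real.exp (inner ℝ φ ψ * l ^ 2) := by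
  have h := hW.integral_exp (φ + (1 : ℝ) • ψ) l
  rw [integral_congr_ae (g := fun ω => Real.exp (l * W φ ω) * Real.exp (l * W ψ ω))] at h
  · rw [h, ← Real.exp_add, one_smul, inner_add_left, inner_add_right, inner_add_right,
      real_inner_comm φ ψ]
    ring_nf
  · filter_upwards [hW.ae_eq_add_smul 1 φ ψ] with ω hω
    rw [hω, ← Real.exp_add]
    ring_nf

/-- A Gaussian sequence with constant variance and a decorrelated subsequence is almost surely
unbounded above. -/
theorem measure_setOf_forall_le_eq_zero (hW : IsWhiteNoise P W)
    {φ : ℕ → Lp ℝ 2 (volume : Measure Plane)} {v : ℝ} (hv : 0 < v)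
    (hφ : ∀ k, inner ℝ (φ k) (φ k) = v)
    (hdec : ∀ δ > 0, ∃ ι : ℕ → ℕ, ∀ i j, i ≠ j → inner ℝ (φ (ι i)) (φ (ι j)) ≤ δ) (M : ℝ) :
    P {ω | ∀ k, W (φ k) ω ≤ M} = 0 := by
  -- This `l` makes v l²/2 = l(|M| + 1) > l M: the mean `c` of exp(l W) then exceeds exp(l M) by the
  -- gap `d`, although `M` may lie above the mean of W.
  set l : ℝ := 2 * (|M| + 1) / v with hl
  have hlpos : 0 < l := by positivity
  set c : ℝ := Real.exp (v * l ^ 2 / 2) with hc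
  set d : ℝ := c - Real.exp (l * M) with hd
  have hdpos : 0 < d := by
    rw [hd, sub_pos, hc, Real.exp_lt_exp]
    have : v * l ^ 2 / 2 = l * (|M| + 1) := by rw [hl]; field_simp
    rw [this]
    exact mul_lt_mul_of_pos_left (by linarith [le_abs_self M]) hlpos
  set p : ℝ := P.real {ω | ∀ k, W (φ k) ω ≤ M} with hp
  set D : ℝ := Real.exp (v * l ^ 2) with hD
  have hcc : c * c = D := by rw [hc, hD, ← Real.exp_add]; ring_nf
  -- Chebyshev for a sum of `N` centered exponentials: on the event each is at most −d, while
  -- off-diagonal covariances are at most D ε. Exponentials need only an upper bound on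
  -- correlations.
  have key : ∀ ε > 0, ∀ N : ℕ, (N : ℝ) ^ 2 * d ^ 2 * p ≤ N * (D * D) + N ^ 2 * (D * ε) := by
    intro ε hε N
    obtain ⟨ι, hι⟩ := hdec (Real.log (1 + ε) / l ^ 2)
      (div_pos (Real.log_pos (by linarith)) (by positivity))
    set Y : ℕ → Ω → ℝ := fun i ω => Real.exp (l * W (φ (ι i)) ω) - c with hY
    have hYY : ∀ i j, (fun ω => Y i ω * Y j ω) = fun ω =>
        Real.exp (l * W (φ (ι i)) ω) * Real.exp (l * W (φ (ι j)) ω)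
        - c * Real.exp (l * W (φ (ι i)) ω) - c * Real.exp (l * W (φ (ι j)) ω) + c * c := by
      intro i j; funext ω; simp only [hY]; ring
    have i1 := hW.integrable_exp_mul_exp
    have i2 : ∀ i, Integrable (fun ω => c * Real.exp (l * W (φ (ι i)) ω)) P :=
      fun i => (hW.integrable_exp _ _).const_mul _
    have hint : ∀ i j, Integrable (fun ω => Y i ω * Y j ω) P := fun i j => by
      rw [hYY]
      exact (((i1 _ _ _).sub (i2 i)).sub (i2 j)).add (integrable_const _)
    have hval : ∀ i j, ∫ ω, Y i ω * Y j ω ∂P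
        = D * (Real.exp (inner ℝ (φ (ι i)) (φ (ι j)) * l ^ 2) - 1) := by
      intro i j
      have i3 : Integrable (fun ω => Real.exp (l * W (φ (ι i)) ω) * Real.exp (l * W (φ (ι j)) ω)
          - c * Real.exp (l * W (φ (ι i)) ω)) P := (i1 _ _ _).sub (i2 i)
      rw [hYY, integral_add (by exact i3.sub (i2 j)) (integrable_const _),
        integral_sub i3 (i2 j), integral_sub (i1 _ _ _) (i2 i), integral_const_mul, integral_const_mul, hW.integral_exp, hW.integral_exp,
        hW.integral_exp_mul_exp, hφ, hφ, ← hc]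
      have : (v + v) * l ^ 2 / 2 = v * l ^ 2 := by ring
      rw [this, ← hD, ← hcc]
      simp
      ring
    have hle : ∀ i j, ∫ ω, Y i ω * Y j ω ∂P ≤ (if i = j then D * D else 0) + D * ε := by
      intro i j
      have hDpos : 0 < D := Real.exp_pos _
      rw [hval]
      split_ifs with hij
      · subst hij
        rw [hφ, ← hD]
        nlinarith
      · have h1 : inner ℝ (φ (ι i)) (φ (ι j)) * l ^ 2 ≤ Real.log (1 + ε) :=
          (le_div_iff₀ (by positivity)).1 (hι i j hij)
        have h2 := Real.exp_le_exp.2 h1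
        rw [Real.exp_log (by linarith)] at h2
        rw [zero_add]
        exact mul_le_mul_of_nonneg_left (by linarith) hDpos.le
    have hexp : (fun ω => (∑ i ∈ Finset.range N, Y i ω) ^ 2)
        = fun ω => ∑ i ∈ Finset.range N, ∑ j ∈ Finset.range N, Y i ω * Y j ω := by
      funext ω
      rw [pow_two, Finset.sum_mul_sum]
    have hint2 : Integrable (fun ω => (∑ i ∈ Finset.range N, Y i ω) ^ 2) P := by
      rw [hexp]
      exact integrable_finsetSum _ fun i _ => integrable_finsetSum _ fun j _ => hint i j
    have hmk := mul_meas_ge_le_integral_of_nonneg (ae_of_all _ fun ω => sq_nonneg _) hint2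
      ((N : ℝ) ^ 2 * d ^ 2)
    refine le_trans ?_ (hmk.trans ?_)
    · refine mul_le_mul_of_nonneg_left (measureReal_mono fun ω hω => ?_) (by positivity)
      have h1 : ∑ i ∈ Finset.range N, Y i ω ≤ ∑ i ∈ Finset.range N, (-d) := by
        refine Finset.sum_le_sum fun i _ => ?_
        have := Real.exp_le_exp.2 (mul_le_mul_of_nonneg_left (hω (ι i)) hlpos.le)
        simp only [hY, hd]
        linarith
      simp only [Finset.sum_const, Finset.card_range, nsmul_eq_mul] at h1
      have h3 : 0 ≤ (N : ℝ) * d := by positivity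
      simp only [Set.mem_ofPred_eq]
      nlinarith
    · rw [hexp, integral_finsetSum _ fun i _ => integrable_finsetSum _ fun j _ => hint i j]
      simp_rw [integral_finsetSum (Finset.range N) fun j _ => hint _ j]
      refine (Finset.sum_le_sum fun i _ => Finset.sum_le_sum fun j _ => hle i j).trans ?_
      simp only [Finset.sum_add_distrib, Finset.sum_ite_eq, Finset.sum_const, Finset.card_range,
        nsmul_eq_mul]
      rw [Finset.sum_ite_mem, Finset.inter_self]
      simp only [Finset.sum_const, Finset.card_range, nsmul_eq_mul]
      apply le_of_eq
      ring
  have hp0 : p = 0 := by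
    by_contra hne
    have hppos : 0 < p := lt_of_le_of_ne measureReal_nonneg (Ne.symm hne)
    have hDpos : 0 < D := Real.exp_pos _
    obtain ⟨N, hN⟩ := exists_nat_gt (2 * (D * D) / (d ^ 2 * p))
    -- This ε makes the off-diagonal term half of the left side; the diagonal is only linear in `N`.
    have h1 := key (d ^ 2 * p / (2 * D)) (by positivity) N
    have hNpos : (0 : ℝ) < N := lt_of_le_of_lt (by positivity) hN
    rw [div_lt_iff₀ (by positivity)] at hN
    have h2 : D * (d ^ 2 * p / (2 * D)) = d ^ 2 * p / 2 := by field_simp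
    rw [h2] at h1
    nlinarith
  rwa [hp, measureReal_eq_zero_iff] at hp0

end IsWhiteNoise

/-- Almost surely, the field takes along the first axis a value larger than its value at `0`. -/
theorem IsConvolvedNoise.ae_exists_lt [IsProbabilityMeasure P] {q : Plane → ℝ}
    (hq : IsAdmissibleKernel q) (hW : IsWhiteNoise P W) {f : Ω → Plane → ℝ}
    (hf : IsConvolvedNoise P W hq.memLp_self f) :
    ∀ᵐ ω ∂P, ∃ s : ℝ, 0 < s ∧ f ω 0 < f ω (s • unitVec 0) := by
  set φ : ℕ → Lp ℝ 2 (volume : Measure Plane) :=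
    fun k => translateL2 hq.memLp_self ((k : ℝ) • unitVec 0) with hφ
  have hzero : ∀ M : ℕ, ∀ᵐ ω ∂P, ¬ ∀ k, W (φ k) ω ≤ M := fun M => by
    rw [ae_iff]
    simp only [not_not]
    refine hW.measure_setOf_forall_le_eq_zero hq.axisCorr_zero_pos (fun k => ?_) ?_ M
    · rw [inner_translateL2_axis, sub_self]
    · intro δ hδ
      obtain ⟨L, hL⟩ := eventually_atTop.1
        (hq.tendsto_axisCorr.eventually (eventually_le_nhds hδ))
      obtain ⟨m, hm⟩ := exists_nat_ge L
      have hlt : ∀ i j : ℕ, i < j →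
          inner ℝ (φ (i * m)) (φ (j * m)) ≤ δ := by
        intro i j hij
        rw [inner_translateL2_axis]
        refine hL _ (hm.trans ?_)
        have : ((i : ℝ) + 1) * m ≤ j * m := by
          have : (i + 1 : ℝ) ≤ j := by exact_mod_cast hij
          gcongr
        push_cast
        linarith
      refine ⟨fun i => i * m, fun i j hij => ?_⟩
      rcases hij.lt_or_gt with h | h
      · exact hlt i j h
      · rw [real_inner_comm]
        exact hlt j i h
  filter_upwards [ae_all_iff.2 hzero, ae_all_iff.2 fun k : ℕ => hf.ae_eq ((k : ℝ) • unitVec 0)]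
    with ω h1 h2
  obtain ⟨M, hM⟩ := exists_nat_ge (f ω 0)
  have := h1 M
  push Not at this
  obtain ⟨k, hk⟩ := this
  rw [← h2 k] at hk
  have hlt := hM.trans_lt hk
  refine ⟨k, ?_, hlt⟩
  rcases Nat.eq_zero_or_pos k with rfl | h
  · simp at hlt
  · exact_mod_cast h

end WhiteNoise

/-! ### Almost sure uniqueness of the maximizer. -/

section UniqueMaximizer

/-- Two families of affine functions with separated slopes have equal finite suprema at one point
at most. -/
theorem subsingleton_setOf_ciSup_eq {ι : Type*} {A B : Set ι} [Nonempty A] [Nonempty B]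
    (y h : ι → ℝ) {ρ ρ' : ℝ} (hρ : ρ < ρ') (hA : ∀ i ∈ A, h i ≤ ρ) (hB : ∀ i ∈ B, ρ' ≤ h i) :
    {z : ℝ | BddAbove (Set.range fun i : A => y i + h i * z) ∧
      BddAbove (Set.range fun i : B => y i + h i * z) ∧
      ⨆ i : A, (y i + h i * z) = ⨆ i : B, (y i + h i * z)}.Subsingleton := by
  have key : ∀ z z' : ℝ, z < z' →
      BddAbove (Set.range fun i : A => y i + h i * z) →
      BddAbove (Set.range fun i : B => y i + h i * z') →
      ⨆ i : A, (y i + h i * z) = ⨆ i : B, (y i + h i * z) →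
      ⨆ i : A, (y i + h i * z') = ⨆ i : B, (y i + h i * z') → False := by
    intro z z' hzz hbA hbB hz hz'
    -- From z to z' the supremum over `A` rises by at most ρ(z' − z), that over `B` by at least
    -- ρ'(z' − z): equality cannot hold at both ends.
    have h1 : ⨆ i : A, (y i + h i * z') ≤ (⨆ i : A, (y i + h i * z)) + ρ * (z' - z) := by
      refine ciSup_le fun i => ?_
      have := le_ciSup hbA i
      nlinarith [hA i i.2]
    have h2 : ⨆ i : B, (y i + h i * z) ≤ (⨆ i : B, (y i + h i * z')) - ρ' * (z' - z) := by
      refine ciSup_le fun i => ?_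
      have := le_ciSup hbB i
      nlinarith [hB i i.2]
    nlinarith
  rintro z ⟨h1, h2, h3⟩ z' ⟨h1', h2', h3'⟩
  rcases lt_trichotomy z z' with h | h | h
  · exact (key z z' h h1 h2' h3 h3').elim
  · exact h
  · exact (key z' z h h1' h2 h3' h3).elim

variable {Ω : Type*} [MeasurableSpace Ω] {P : Measure Ω} [IsProbabilityMeasure P]

/-- If `Z` has no atoms and is independent of `Y`, the suprema of `Y i + h i * Z` over two families
of indices with separated slopes `h i` are almost surely different. -/
theorem ae_not_exists_isLUB {ι : Type*} [Countable ι] {Z : Ω → ℝ} {Y : Ω → ι → ℝ}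
    (hZ : AEMeasurable Z P) (hY : AEMeasurable Y P) (hind : IndepFun Y Z P)
    [NullSingletonClass (P.map Z)] (h : ι → ℝ) {A B : Set ι} {ρ ρ' : ℝ} (hρ : ρ < ρ')
    (hA : ∀ i ∈ A, h i ≤ ρ) (hB : ∀ i ∈ B, ρ' ≤ h i) :
    ∀ᵐ ω ∂P, ¬ ∃ a, IsLUB ((fun i => Y ω i + h i * Z ω) '' A) a ∧
      IsLUB ((fun i => Y ω i + h i * Z ω) '' B) a := by
  rcases A.eq_empty_or_nonempty with rfl | hAne
  · refine ae_of_all _ ?_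
    rintro ω ⟨a, ha, -⟩
    simpa using ha.nonempty
  rcases B.eq_empty_or_nonempty with rfl | hBne
  · refine ae_of_all _ ?_
    rintro ω ⟨a, -, ha⟩
    simpa using ha.nonempty
  have := hAne.to_subtype
  have := hBne.to_subtype
  set E : Set ((ι → ℝ) × ℝ) := {p | BddAbove (Set.range fun i : A => p.1 i + h i * p.2) ∧
      BddAbove (Set.range fun i : B => p.1 i + h i * p.2) ∧
      ⨆ i : A, (p.1 i + h i * p.2) = ⨆ i : B, (p.1 i + h i * p.2)} with hE
  have hmi : ∀ i : ι, Measurable fun p : (ι → ℝ) × ℝ => p.1 i + h i * p.2 := fun i => by fun_prop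
  have hEm : MeasurableSet E :=
    (measurableSet_bddAbove_range fun i : A => hmi i).inter
      ((measurableSet_bddAbove_range fun i : B => hmi i).inter
        (measurableSet_eq_fun (Measurable.iSup fun i : A => hmi i)
          (Measurable.iSup fun i : B => hmi i)))
  -- By Fubini: every section of `E` has at most one point, and the law of `Z` has no atoms.
  have hnull : (P.map Y).prod (P.map Z) E = 0 := by
    refine Measure.measure_prod_null_of_ae_null hEm (ae_of_all _ fun y => ?_)
    exact (subsingleton_setOf_ciSup_eq y h hρ hA hB).measure_zero _
  rw [← (indepFun_iff_map_prod_eq_prod_map_map hY hZ).1 hind,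
    Measure.map_apply_of_aemeasurable (hY.prodMk hZ) hEm] at hnull
  filter_upwards [measure_eq_zero_iff_ae_notMem.1 hnull] with ω hω
  rintro ⟨a, ha, hb⟩
  rw [Set.image_eq_range] at ha hb
  exact hω ⟨ha.bddAbove, hb.bddAbove, ha.ciSup_eq.trans hb.ciSup_eq.symm⟩

variable {W : Lp ℝ 2 (volume : Measure Plane) → Ω → ℝ}

theorem IsWhiteNoise.nullSingletonClass_map (hW : IsWhiteNoise P W)
    {φ : Lp ℝ 2 (volume : Measure Plane)} (hφ : 0 < (inner ℝ φ φ : ℝ)) :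
    NullSingletonClass (P.map (W φ)) := by
  rw [hW.map_eq_gaussianReal]
  exact nullSingletonClass_gaussianReal (Real.toNNReal_pos.2 hφ).ne'

theorem IsWhiteNoise.indepFun (hW : IsWhiteNoise P W) {ι : Type*}
    {η : ι → Lp ℝ 2 (volume : Measure Plane)} {φ : Lp ℝ 2 (volume : Measure Plane)}
    (hη : ∀ i, inner ℝ (η i) φ = 0) : IndepFun (fun ω i => W (η i) ω) (W φ) P := by
  have hG : IsGaussianProcess
      (Sum.elim (fun i => W (η i)) fun _ : Unit => W φ) P := by
    have h : Sum.elim (fun i => W (η i)) (fun _ : Unit => W φ)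
        = W ∘ Sum.elim η fun _ : Unit => φ := by
      ext i
      rcases i with i | i <;> rfl
    rw [h]
    exact hW.isGaussianProcess.comp_right _
  have h := hG.indepFun_of_covariance_eq_zero (fun i => hW.aemeasurable _)
    (fun _ => hW.aemeasurable _) (fun i _ => by
      rw [covariance_eq_sub (hW.memLp_two _) (hW.memLp_two _), hW.centered, zero_mul, sub_zero]
      exact (hW.covariance _ _).trans (hη i))
  exact h.comp measurable_id (measurable_pi_apply ())

/-- Orthogonal projection of each `η i` on `φ` writes W(η i) as an affine function of W(φ), whose
remainder is independent of W(φ) since orthogonality means independence for Gaussians. -/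
theorem IsWhiteNoise.ae_not_exists_isLUB (hW : IsWhiteNoise P W) {ι : Type*} [Countable ι]
    (η : ι → Lp ℝ 2 (volume : Measure Plane)) {φ : Lp ℝ 2 (volume : Measure Plane)}
    (hφ : 0 < (inner ℝ φ φ : ℝ)) {A B : Set ι} {ρ ρ' : ℝ} (hρ : ρ < ρ')
    (hA : ∀ i ∈ A, inner ℝ (η i) φ ≤ ρ) (hB : ∀ i ∈ B, ρ' ≤ inner ℝ (η i) φ) :
    ∀ᵐ ω ∂P, ¬ ∃ a, IsLUB ((fun i => W (η i) ω) '' A) a ∧ IsLUB ((fun i => W (η i) ω) '' B) a := by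
  set v : ℝ := inner ℝ φ φ with hv
  set c : ι → ℝ := fun i => inner ℝ (η i) φ / v with hc
  set θ : ι → Lp ℝ 2 (volume : Measure Plane) := fun i => η i - c i • φ with hθ
  have hθφ : ∀ i, inner ℝ (θ i) φ = 0 := fun i => by
    rw [hθ, inner_sub_left, real_inner_smul_left, ← hv, hc]
    field_simp
    simp
  have := hW.nullSingletonClass_map hφ
  have h1 := _root_.ae_not_exists_isLUB (hW.aemeasurable φ)
    (aemeasurable_pi_lambda _ fun i => hW.aemeasurable (θ i)) (hW.indepFun hθφ) c
    (div_lt_div_of_pos_right hρ hφ) (fun i hi => div_le_div_of_nonneg_right (hA i hi) hφ.le)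
    (fun i hi => div_le_div_of_nonneg_right (hB i hi) hφ.le)
  have h2 : ∀ᵐ ω ∂P, ∀ i, W (η i) ω = W (θ i) ω + c i * W φ ω := by
    refine ae_all_iff.2 fun i => ?_
    have := hW.ae_eq_add_smul (c i) (θ i) φ
    rwa [hθ, sub_add_cancel] at this
  filter_upwards [h1, h2] with ω hω1 hω2
  simpa only [hω2] using hω1

omit [IsProbabilityMeasure P] in
theorem IsWhiteNoise.ae_eq_smul_sub (hW : IsWhiteNoise P W) (c : ℝ)
    (φ ψ : Lp ℝ 2 (volume : Measure Plane)) :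
    ∀ᵐ ω ∂P, W (c • (φ - ψ)) ω = c * (W φ ω - W ψ ω) := by
  filter_upwards [hW.ae_eq_add_smul 1 0 0, hW.ae_eq_add_smul c 0 (φ - ψ),
    hW.ae_eq_add_smul (-1) φ ψ] with ω h1 h2 h3
  rw [one_smul, add_zero] at h1
  rw [zero_add] at h2
  rw [neg_one_smul, ← sub_eq_add_neg] at h3
  rw [h2, h3]
  linarith

namespace IsConvolvedNoise

variable {q : Plane → ℝ} {f : Ω → Plane → ℝ}

theorem ae_not_exists_isLUB_tau (hq : IsAdmissibleKernel q) (hW : IsWhiteNoise P W)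
    (hf : IsConvolvedNoise P W hq.memLp_self f) (u : ℝ) {ρ ρ' : ℝ} (hρ : ρ < ρ') :
    ∀ᵐ ω ∂P, ¬ ∃ a,
      IsLUB ((fun d : {d : ℚ // 0 < d} => tau (f ω) (d : ℚ) 0) '' {d | slopeCov q u (d : ℚ) ≤ ρ}) a ∧
      IsLUB ((fun d : {d : ℚ // 0 < d} => tau (f ω) (d : ℚ) 0) '' {d | ρ' ≤ slopeCov q u (d : ℚ)})
        a := by
  set T : ℝ → Lp ℝ 2 (volume : Measure Plane) :=
    fun s => translateL2 hq.memLp_self (s • unitVec 0) with hT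
  set η : {d : ℚ // 0 < d} → Lp ℝ 2 (volume : Measure Plane) :=
    fun d => ((d : ℚ) : ℝ)⁻¹ • (T (d : ℚ) - T 0) with hη
  have hpos : ∀ d : {d : ℚ // 0 < d}, (0 : ℝ) < (d : ℚ) := fun d => by exact_mod_cast d.2
  have hin : ∀ d, inner ℝ (η d) (T u) = slopeCov q u (d : ℚ) := fun d => by
    rw [slopeCov_of_pos (hpos d), hη, real_inner_smul_left, inner_sub_left,
      inner_translateL2_axis, inner_translateL2_axis, sub_zero]
  have hTu : 0 < (inner ℝ (T u) (T u) : ℝ) := by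
    rw [inner_translateL2_axis, sub_self]
    exact hq.axisCorr_zero_pos
  have h1 := hW.ae_not_exists_isLUB η hTu hρ (A := {d | slopeCov q u (d : ℚ) ≤ ρ})
    (B := {d | ρ' ≤ slopeCov q u (d : ℚ)}) (fun i hi => (hin i).trans_le hi)
    (fun i hi => (hin i).symm ▸ hi)
  have h2 : ∀ᵐ ω ∂P, ∀ d : {d : ℚ // 0 < d}, W (η d) ω = tau (f ω) (d : ℚ) 0 := by
    refine ae_all_iff.2 fun d => ?_
    filter_upwards [hW.ae_eq_smul_sub ((d : ℚ) : ℝ)⁻¹ (T (d : ℚ)) (T 0),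
      hf.ae_eq (((d : ℚ) : ℝ) • unitVec 0), hf.ae_eq ((0 : ℝ) • unitVec 0)] with ω h3 h4 h5
    have h6 : f ω 0 = W (T 0) ω := by rw [hT, ← h5, zero_smul]
    rw [h3, tau_of_pos (hpos d), zero_add, h4, h6, smul_eq_mul]
  filter_upwards [h1, h2] with ω hω1 hω2
  simpa only [hω2] using hω1

end IsConvolvedNoise

/-- Right continuity of the slope at `s` lets rational times just after `s` recover the maximum, so
an uncountable question reduces to countable families. -/
theorem isLUB_image_tau {g : Plane → ℝ} (hg : ContDiff ℝ 1 g) {s : ℝ} (hs : 0 ≤ s)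
    (hmax : ∀ t : ℝ, 0 ≤ t → tau g t 0 ≤ tau g s 0) {A : Set {d : ℚ // 0 < d}}
    (hA : ∀ᶠ t : ℝ in 𝓝[>] s, ∀ d : {d : ℚ // 0 < d}, ((d : ℚ) : ℝ) = t → d ∈ A) :
    IsLUB ((fun d : {d : ℚ // 0 < d} => tau g (d : ℚ) 0) '' A) (tau g s 0) := by
  constructor
  · rintro _ ⟨d, -, rfl⟩
    exact hmax _ (by exact_mod_cast d.2.le)
  · intro b hb
    by_contra! hlt
    have hcont : Continuous fun t : Set.Ici (0 : ℝ) => tau g t 0 :=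
      (continuous_tau hg).comp (by fun_prop : Continuous fun t : Set.Ici (0 : ℝ) => (t, (0 : Plane)))
    have h1 : ContinuousWithinAt (fun t : ℝ => tau g t 0) (Set.Ici 0) s :=
      (continuousOn_iff_continuous_domRestrict.2 hcont) s hs
    have h2 : ∀ᶠ t : ℝ in 𝓝[>] s, b < tau g t 0 :=
      (h1.mono fun t ht => hs.trans (le_of_lt ht)).eventually (eventually_gt_nhds hlt)
    obtain ⟨w, hw, hsub⟩ := mem_nhdsGT_iff_exists_Ioo_subset.1 (h2.and hA)
    obtain ⟨d, hd1, hd2⟩ := exists_rat_btwn (Set.mem_Ioi.1 hw)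
    have hd := hsub ⟨hd1, hd2⟩
    have hdpos : 0 < d := by exact_mod_cast hs.trans_lt hd1
    exact absurd (hb ⟨⟨d, hdpos⟩, hd.2 ⟨d, hdpos⟩ rfl, rfl⟩) (not_le.2 hd.1)

namespace IsConvolvedNoise

variable {q : Plane → ℝ} {f : Ω → Plane → ℝ}

/-- Almost surely, the slope at `0` is maximal for one `t` at most. -/
theorem ae_unique_max (hq : IsAdmissibleKernel q) (hW : IsWhiteNoise P W)
    (hf : IsConvolvedNoise P W hq.memLp_self f) :
    ∀ᵐ ω ∂P, ∀ s t : ℝ, 0 ≤ s → 0 ≤ t → (∀ r : ℝ, 0 ≤ r → tau (f ω) r 0 ≤ tau (f ω) s 0) →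
      (∀ r : ℝ, 0 ≤ r → tau (f ω) r 0 ≤ tau (f ω) t 0) → s = t := by
  have h1 : ∀ᵐ ω ∂P, ∀ u ρ ρ' : ℚ, ρ < ρ' → ¬ ∃ a,
      IsLUB ((fun d : {d : ℚ // 0 < d} => tau (f ω) (d : ℚ) 0) '' {d | slopeCov q u (d : ℚ) ≤ ρ}) a ∧
      IsLUB ((fun d : {d : ℚ // 0 < d} => tau (f ω) (d : ℚ) 0) '' {d | ρ' ≤ slopeCov q u (d : ℚ)})
        a := by
    simp only [ae_all_iff]
    exact fun u ρ ρ' hρ => hf.ae_not_exists_isLUB_tau hq hW u (by exact_mod_cast hρ)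
  filter_upwards [h1, hf.ae_contDiff] with ω hω hc
  have hc1 : ContDiff ℝ 1 (f ω) := hc.of_le (by norm_num)
  have hsep : ∀ (u : ℚ) (s t : ℝ), 0 ≤ s → 0 ≤ t →
      (∀ r : ℝ, 0 ≤ r → tau (f ω) r 0 ≤ tau (f ω) s 0) →
      (∀ r : ℝ, 0 ≤ r → tau (f ω) r 0 ≤ tau (f ω) t 0) → ¬ slopeCov q u s < slopeCov q u t := by
    intro u s t hs ht hsmax htmax hlt
    obtain ⟨ρ, hρ1, hρ2⟩ := exists_rat_btwn hlt
    obtain ⟨ρ', hρ'1, hρ'2⟩ := exists_rat_btwn hρ2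
    -- Both families have the same least upper bound, the maximal slope: one approaches it near `s`,
    -- the other near `t`.
    refine hω u ρ ρ' (by exact_mod_cast hρ'1) ⟨tau (f ω) s 0,
      isLUB_image_tau hc1 hs hsmax ?_, ?_⟩
    · filter_upwards [(hq.tendsto_slopeCov u hs).eventually (eventually_lt_nhds hρ1)] with r hr d hd
      rw [← hd] at hr
      exact hr.le
    · rw [le_antisymm (htmax s hs) (hsmax t ht)]
      refine isLUB_image_tau hc1 ht htmax ?_
      filter_upwards [(hq.tendsto_slopeCov u ht).eventually (eventually_gt_nhds hρ'2)] with r hr d hd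
      rw [← hd] at hr
      exact hr.le
  have hlt : ∀ s t : ℝ, 0 ≤ s → 0 ≤ t →
      (∀ r : ℝ, 0 ≤ r → tau (f ω) r 0 ≤ tau (f ω) s 0) →
      (∀ r : ℝ, 0 ≤ r → tau (f ω) r 0 ≤ tau (f ω) t 0) → ¬ s < t := by
    intro s t hs ht hsmax htmax hst
    obtain ⟨u, hu⟩ := hq.exists_rat_slopeCov_ne hs hst
    rcases hu.lt_or_gt with h | h
    · exact hsep u s t hs ht hsmax htmax h
    · exact hsep u t s ht hs htmax hsmax h
  intro s t hs ht hsmax htmax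
  exact le_antisymm (not_lt.1 (hlt t s ht hs htmax hsmax)) (not_lt.1 (hlt s t hs ht hsmax htmax))

end IsConvolvedNoise

end UniqueMaximizer

/-! ### Uniform Gaussian tails and growth of the field. -/

section Growth

/-- A uniform version of Fernique's theorem: the Gaussian tail of a rotation invariant measure is
controlled by a quantile only. -/
theorem exists_measure_lt_norm_le_of_rotation {a : ℝ} (ha : 0 < a) :
    ∃ κ : ℝ, 0 < κ ∧ ∃ K : ℝ≥0∞, K ≠ ∞ ∧ ∀ {E : Type} [NormedAddCommGroup E] [NormedSpace ℝ E]
      [SecondCountableTopology E] [MeasurableSpace E] [BorelSpace E] (μ : Measure E)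
      [IsProbabilityMeasure μ],
      (μ.prod μ).map (ContinuousLinearMap.rotation (-(Real.pi / 4))) = μ.prod μ →
      3 / 4 ≤ μ {x | ‖x‖ ≤ a} → ∀ s : ℝ, 0 ≤ s →
      μ {x | s < ‖x‖} ≤ K * ENNReal.ofReal (Real.exp (-(κ * s ^ 2))) := by
  have h34 : (3 / 4 : ℝ≥0∞) = ENNReal.ofReal (3 / 4) := by
    rw [ENNReal.ofReal_div_of_pos (by norm_num)]
    simp
  have h14 : (1 : ℝ≥0∞) - 3 / 4 = ENNReal.ofReal (1 / 4) := by
    rw [h34, ← ENNReal.ofReal_one, ← ENNReal.ofReal_sub _ (by norm_num)]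
    norm_num
  have hc_gt : (2 : ℝ≥0∞)⁻¹ < 3 / 4 := by
    rw [h34, ← ENNReal.ofReal_ofNat, ← ENNReal.ofReal_inv_of_pos (by norm_num)]
    exact (ENNReal.ofReal_lt_ofReal_iff (by norm_num)).2 (by norm_num)
  have hc_lt : (3 / 4 : ℝ≥0∞) < 1 := by
    rw [h34, ← ENNReal.ofReal_one]
    exact (ENNReal.ofReal_lt_ofReal_iff (by norm_num)).2 (by norm_num)
  have hratio : ((3 / 4 : ℝ≥0∞) / (1 - 3 / 4)).toReal = 3 := by
    rw [ENNReal.toReal_div, h14, h34, ENNReal.toReal_ofReal (by norm_num),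
      ENNReal.toReal_ofReal (by norm_num)]
    norm_num
  -- The constants depend on `a` alone, not on the space or measure; this lets the dimension of the
  -- finite blocks grow later.
  refine ⟨Fernique.logRatio (3 / 4) * a⁻¹ ^ 2,
    mul_pos (Fernique.logRatio_pos hc_gt hc_lt) (by positivity),
    .ofReal (Real.exp (Fernique.logRatio (3 / 4)))
        + ∑' n : ℕ, .ofReal (Real.exp (-2⁻¹ * Real.log (3 / 4 / (1 - 3 / 4) : ℝ≥0∞).toReal * 2 ^ n)),
    ?_, ?_⟩
  · refine (ENNReal.add_lt_top.mpr ⟨ENNReal.ofReal_lt_top, ?_⟩).ne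
    refine Summable.tsum_ofReal_lt_top <|
      Real.summable_exp_nat_mul_of_ge ?_ (fun i => mod_cast (Nat.lt_pow_self (by simp)).le)
    rw [hratio]
    exact mul_neg_of_neg_of_pos (by norm_num) (Real.log_pos (by norm_num))
  · intro E _ _ _ _ _ μ _ hrot hμ s hs
    set κ := Fernique.logRatio (3 / 4) * a⁻¹ ^ 2 with hκ
    have hκ0 : 0 < κ := mul_pos (Fernique.logRatio_pos hc_gt hc_lt) (by positivity)
    have h1 := lintegral_exp_mul_sq_norm_le_of_map_rotation_eq_self hrot hμ hc_gt
    have h2 := mul_meas_ge_le_lintegral₀ (μ := μ)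
      (f := fun x => ENNReal.ofReal (Real.exp (κ * ‖x‖ ^ 2))) (by fun_prop)
      (ENNReal.ofReal (Real.exp (κ * s ^ 2)))
    have h3 := h2.trans h1
    rw [Real.exp_neg, ENNReal.ofReal_inv_of_pos (Real.exp_pos _), ← div_eq_mul_inv,
      ENNReal.le_div_iff_mul_le (by simp [Real.exp_pos]) (by simp), mul_comm]
    refine le_trans ?_ h3
    gcongr
    rename_i x
    intro hx
    have : s ≤ ‖x‖ := le_of_lt hx
    gcongr

variable {Ω : Type*} [MeasurableSpace Ω] {P : Measure Ω} [IsProbabilityMeasure P]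
  {W : Lp ℝ 2 (volume : Measure Plane) → Ω → ℝ}

namespace IsWhiteNoise

omit [IsProbabilityMeasure P] in
theorem hasGaussianLaw_restrict (hW : IsWhiteNoise P W) (φ : ℕ → Lp ℝ 2 (volume : Measure Plane))
    (I : Finset ℕ) : HasGaussianLaw (fun ω (k : I) => W (φ k) ω) P :=
  (hW.isGaussianProcess.comp_right φ).hasGaussianLaw I

theorem integral_sum_mul (hW : IsWhiteNoise P W) (φ : ℕ → Lp ℝ 2 (volume : Measure Plane))
    (I : Finset ℕ) (c : I → ℝ) : ∫ ω, ∑ k : I, W (φ k) ω * c k ∂P = 0 := by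
  rw [integral_finsetSum _ fun k _ => ((hW.memLp_two _).integrable one_le_two).mul_const _]
  simp [integral_mul_const, hW.centered]

theorem variance_sum_mul (hW : IsWhiteNoise P W) (φ : ℕ → Lp ℝ 2 (volume : Measure Plane))
    (I : Finset ℕ) (c : I → ℝ) : Var[fun ω => ∑ k : I, W (φ k) ω * c k; P]
      = ∑ k : I, ∑ l : I, inner ℝ (φ k) (φ l) * (c k * c l) := by
  have hm : MemLp (fun ω => ∑ k : I, W (φ k) ω * c k) 2 P :=
    memLp_finsetSum _ fun k _ => (hW.memLp_two (φ k)).mul_const (c k)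
  rw [variance_eq_sub hm, hW.integral_sum_mul]
  have h : ((fun ω => ∑ k : I, W (φ k) ω * c k) ^ 2)
      = fun ω => ∑ k : I, ∑ l : I, (W (φ k) ω * W (φ l) ω) * (c k * c l) := by
    funext ω
    simp only [Pi.pow_apply, pow_two, Finset.sum_mul_sum]
    exact Finset.sum_congr rfl fun k _ => Finset.sum_congr rfl fun l _ => by ring
  rw [h, integral_finsetSum _ fun k _ => integrable_finsetSum _ fun l _ =>
    (hW.integrable_mul _ _).mul_const _]
  simp_rw [integral_finsetSum (Finset.univ : Finset I) fun l _ =>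
    (hW.integrable_mul (φ _) (φ l)).mul_const _, integral_mul_const, hW.covariance]
  simp

/-- A centered Gaussian vector has its characteristic function, hence its law, determined by the
covariances. -/
theorem map_restrict_eq (hW : IsWhiteNoise P W) {φ ψ : ℕ → Lp ℝ 2 (volume : Measure Plane)}
    (h : ∀ k l, (inner ℝ (φ k) (φ l) : ℝ) = inner ℝ (ψ k) (ψ l)) (I : Finset ℕ) :
    P.map (fun ω (k : I) => W (φ k) ω) = P.map (fun ω (k : I) => W (ψ k) ω) := by
  have h1 := hW.hasGaussianLaw_restrict φ I
  have h2 := hW.hasGaussianLaw_restrict ψ I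
  have := h1.isGaussian_map
  have := h2.isGaussian_map
  refine Measure.ext_of_charFunDual (funext fun L => ?_)
  have hL : ∀ χ : ℕ → Lp ℝ 2 (volume : Measure Plane), (L ∘ fun ω (k : I) => W (χ k) ω)
      = fun ω => ∑ k : I, W (χ k) ω * L (Pi.single k 1) := fun χ => by
    funext ω
    have h3 := L.toLinearMap.pi_apply_eq_sum_univ fun k : I => W (χ k) ω
    simp only [ContinuousLinearMap.coe_coe, smul_eq_mul] at h3
    rw [Function.comp_apply, h3]
    refine Finset.sum_congr rfl fun k _ => ?_
    congr 2
    funext j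
    simp [Pi.single_apply, eq_comm]
  rw [h1.charFunDual_map_eq, h2.charFunDual_map_eq, hL, hL, hW.integral_sum_mul,
    hW.integral_sum_mul, hW.variance_sum_mul, hW.variance_sum_mul]
  simp_rw [h]

theorem map_rotation_restrict_eq (hW : IsWhiteNoise P W)
    (φ : ℕ → Lp ℝ 2 (volume : Measure Plane)) (I : Finset ℕ) (θ : ℝ) :
    ((P.map (fun ω (k : I) => W (φ k) ω)).prod (P.map (fun ω (k : I) => W (φ k) ω))).map
      (ContinuousLinearMap.rotation θ)
      = (P.map (fun ω (k : I) => W (φ k) ω)).prod (P.map (fun ω (k : I) => W (φ k) ω)) := by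
  have h1 := hW.hasGaussianLaw_restrict φ I
  have := h1.isGaussian_map
  refine IsGaussian.map_rotation_eq_self ?_ θ
  rw [integral_map h1.aemeasurable (by fun_prop)]
  funext k
  simp only [id]
  rw [eval_integral fun k => (hW.memLp_two _).integrable one_le_two]
  exact hW.centered _

/-- A bound for one Gaussian sequence gives uniform tails for all sequences with the same
covariances. -/
theorem exists_measure_exists_lt_le (hW : IsWhiteNoise P W) {a : ℝ} (ha : 0 < a)
    {φ : ℕ → Lp ℝ 2 (volume : Measure Plane)}
    (hφ : 3 / 4 ≤ P {ω | ∀ k, |W (φ k) ω| ≤ a}) :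
    ∃ κ : ℝ, 0 < κ ∧ ∃ K : ℝ≥0∞, K ≠ ∞ ∧ ∀ ψ : ℕ → Lp ℝ 2 (volume : Measure Plane),
      (∀ k l, (inner ℝ (φ k) (φ l) : ℝ) = inner ℝ (ψ k) (ψ l)) → ∀ s : ℝ, 0 ≤ s →
      P {ω | ∃ k, s < |W (ψ k) ω|} ≤ K * ENNReal.ofReal (Real.exp (-(κ * s ^ 2))) := by
  obtain ⟨κ, hκ, K, hK, hmain⟩ := exists_measure_lt_norm_le_of_rotation ha
  refine ⟨κ, hκ, K, hK, fun ψ hψ s hs => ?_⟩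
  have hfin : ∀ n : ℕ, P {ω | ∃ k < n, s < |W (ψ k) ω|}
      ≤ K * ENNReal.ofReal (Real.exp (-(κ * s ^ 2))) := by
    intro n
    have h1 := hW.hasGaussianLaw_restrict ψ (Finset.range n)
    have h2 := hW.hasGaussianLaw_restrict φ (Finset.range n)
    have := h1.isGaussian_map
    have hlow : 3 / 4 ≤ P.map (fun ω (k : Finset.range n) => W (ψ k) ω) {x | ‖x‖ ≤ a} := by
      rw [← hW.map_restrict_eq hψ, Measure.map_apply_of_aemeasurable h2.aemeasurable
        (measurableSet_le (by fun_prop) (by fun_prop))]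
      refine hφ.trans (measure_mono fun ω hω => ?_)
      exact (pi_norm_le_iff_of_nonneg ha.le).2 fun k => hω k
    have h3 := hmain _ (hW.map_rotation_restrict_eq ψ (Finset.range n) _) hlow s hs
    rw [Measure.map_apply_of_aemeasurable h1.aemeasurable
        (measurableSet_lt (by fun_prop) (by fun_prop))] at h3
    refine le_trans (measure_mono ?_) h3
    rintro ω ⟨k, hk, hlt⟩
    exact hlt.trans_le (norm_le_pi_norm (fun k : Finset.range n => W (ψ k) ω)
      ⟨k, Finset.mem_range.2 hk⟩)
  -- The bound does not depend on `n`, so it passes to the increasing union.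
  have hU : {ω | ∃ k, s < |W (ψ k) ω|} = ⋃ n : ℕ, {ω | ∃ k < n, s < |W (ψ k) ω|} := by
    ext ω
    simp only [Set.mem_ofPred_eq, Set.mem_iUnion]
    exact ⟨fun ⟨k, hk⟩ => ⟨k + 1, k, Nat.lt_succ_self k, hk⟩, fun ⟨_, k, _, hk⟩ => ⟨k, hk⟩⟩
  have hmono : Monotone fun n : ℕ => {ω | ∃ k < n, s < |W (ψ k) ω|} :=
    fun n m hnm ω ⟨k, hk, h⟩ => ⟨k, hk.trans_le hnm, h⟩
  rw [hU, hmono.measure_iUnion]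
  exact iSup_le hfin

end IsWhiteNoise

/-- Translations along the first axis do not change the covariances. -/
theorem inner_translateL2_add {q : Plane → ℝ} (hq : MemLp q 2 (volume : Measure Plane))
    (z w v : Plane) : (inner ℝ (translateL2 hq z) (translateL2 hq w) : ℝ)
      = inner ℝ (translateL2 hq (z + v)) (translateL2 hq (w + v)) := by
  rw [inner_translateL2, inner_translateL2, add_sub_add_right_eq_sub]

/-- Almost surely, the field grows at most like a square root along the first axis. -/
theorem IsConvolvedNoise.ae_hasSqrtGrowth (hW : IsWhiteNoise P W) {q : Plane → ℝ}
    {hq : MemLp q 2 (volume : Measure Plane)} {f : Ω → Plane → ℝ}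
    (hf : IsConvolvedNoise P W hq f) : ∀ᵐ ω ∂P, HasSqrtGrowth (f ω) := by
  unfold HasSqrtGrowth
  rw [ae_all_iff]
  intro R
  classical
  -- A sequence dense in the ball of radius `R + 1`, with 0 in place of outside points: countably
  -- many values determine the continuous field there.
  set x : ℕ → Plane := fun k =>
    if TopologicalSpace.denseSeq Plane k ∈ Metric.ball (0 : Plane) (R + 1)
      then TopologicalSpace.denseSeq Plane k else 0 with hx
  have hxmem : ∀ k, x k ∈ Metric.closedBall (0 : Plane) (R + 1) := fun k => by
    simp only [hx]
    split_ifs with h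
    · exact Metric.ball_subset_closedBall h
    · exact Metric.mem_closedBall_self (by positivity)
  have hxdense : Metric.ball (0 : Plane) (R + 1) ⊆ closure (Set.range x) := by
    refine ((TopologicalSpace.denseRange_denseSeq Plane).open_subset_closure_inter
      Metric.isOpen_ball).trans (closure_mono ?_)
    rintro _ ⟨hz, k, rfl⟩
    exact ⟨k, if_pos hz⟩
  set φ : ℕ → ℕ → Lp ℝ 2 (volume : Measure Plane) :=
    fun n k => translateL2 hq (x k + (n : ℝ) • unitVec 0) with hφ
  have hae : ∀ᵐ ω ∂P, ∀ n k : ℕ, f ω (x k + (n : ℝ) • unitVec 0) = W (φ n k) ω := by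
    simp only [ae_all_iff]
    exact fun n k => hf.ae_eq _
  have hae0 : ∀ᵐ ω ∂P, ∀ k : ℕ, f ω (x k) = W (φ 0 k) ω := by
    filter_upwards [hae] with ω hω k
    simpa using hω 0 k
  -- Continuous paths are bounded on the compact ball, so a large enough level has probability at
  -- least 3/4.
  obtain ⟨a, ha, hlow⟩ : ∃ a : ℝ, 0 < a ∧ 3 / 4 ≤ P {ω | ∀ k, |W (φ 0 k) ω| ≤ a} := by
    have hfull : P (⋃ m : ℕ, {ω | ∀ k, |W (φ 0 k) ω| ≤ m}) = 1 := by
      refine (prob_compl_eq_zero_iff₀ ?_).1 ?_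
      · refine NullMeasurableSet.iUnion fun m => ?_
        rw [Set.ofPred_forall]
        exact NullMeasurableSet.iInter fun k =>
          nullMeasurableSet_le (hW.aemeasurable _).abs aemeasurable_const
      · rw [← mem_ae_iff]
        filter_upwards [hae0, hf.ae_contDiff] with ω hω hc
        obtain ⟨C, hC⟩ := (isCompact_closedBall (0 : Plane) (R + 1)).exists_bound_of_continuousOn
          hc.continuous.continuousOn
        obtain ⟨m, hm⟩ := exists_nat_ge C
        refine Set.mem_iUnion.2 ⟨m, fun k => ?_⟩
        rw [← hω]
        exact (hC _ (hxmem k)).trans hm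
    have hmono : Monotone fun m : ℕ => {ω | ∀ k, |W (φ 0 k) ω| ≤ m} :=
      fun m m' hmm ω h k => (h k).trans (by exact_mod_cast hmm)
    rw [hmono.measure_iUnion] at hfull
    have hlt : (3 / 4 : ℝ≥0∞) < ⨆ m : ℕ, P {ω | ∀ k, |W (φ 0 k) ω| ≤ m} := by
      rw [hfull]
      exact ENNReal.div_lt_of_lt_mul (by norm_num)
    obtain ⟨m, hm⟩ := lt_iSup_iff.1 hlt
    exact ⟨m + 1, by positivity, hm.le.trans (measure_mono fun ω h k =>
      (h k).trans (by linarith))⟩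
  obtain ⟨κ, hκ, K, hK, htail⟩ := hW.exists_measure_exists_lt_le ha hlow
  -- At level √n the Gaussian tail is geometric in `n`, as Borel–Cantelli requires.
  have hsum : ∑' n : ℕ, P {ω | ∃ k, √n < |W (φ n k) ω|} ≠ ∞ := by
    have hle : ∀ n : ℕ, P {ω | ∃ k, √n < |W (φ n k) ω|}
        ≤ K * ENNReal.ofReal (Real.exp ((-κ) * n)) := by
      intro n
      have h := htail (φ n) (fun k l => ?_) (√n) (Real.sqrt_nonneg _)
      · rwa [Real.sq_sqrt (Nat.cast_nonneg n), ← neg_mul] at h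
      · simp only [hφ, Nat.cast_zero, zero_smul, add_zero]
        exact inner_translateL2_add hq _ _ _
    refine ne_top_of_le_ne_top ?_ (ENNReal.tsum_le_tsum hle)
    rw [ENNReal.tsum_mul_left]
    refine ENNReal.mul_ne_top hK (Summable.tsum_ofReal_lt_top ?_).ne
    exact Real.summable_exp_nat_mul_of_ge (neg_lt_zero.2 hκ) fun i => le_rfl
  filter_upwards [ae_eventually_notMem hsum, hae, hf.ae_contDiff] with ω hω hω2 hc
  filter_upwards [hω] with n hn z hz
  have hclosed : IsClosed {z : Plane | |f ω (z + (n : ℝ) • unitVec 0)| ≤ √n} :=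
    isClosed_le (by have := hc.continuous; fun_prop) continuous_const
  have hsub : Set.range x ⊆ {z : Plane | |f ω (z + (n : ℝ) • unitVec 0)| ≤ √n} := by
    rintro _ ⟨k, rfl⟩
    have h := not_exists.1 hn k
    rw [← hω2] at h
    exact not_lt.1 h
  refine closure_minimal hsub hclosed (hxdense ?_)
  rw [Metric.mem_ball, dist_zero_right]
  linarith

end Growth

/-! ### Measurability of the maximizer. -/

section Maximizer

/-- A unique maximal slope is reached before `c` if and only if some slope at a rational time
before `c` exceeds all slopes at rational times from `c` on. -/
theorem lt_iff_exists_rat_forall_rat_tau_lt {g : Plane → ℝ} (hg : HasSqrtGrowth g)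
    (hc : ContDiff ℝ 1 g) {s₀ : ℝ} (hs₀ : 0 < s₀) (hpos : g 0 < g (s₀ • unitVec 0)) {T : ℝ}
    (hT : 0 ≤ T) (hmax : ∀ t : ℝ, 0 ≤ t → tau g t 0 ≤ tau g T 0)
    (huniq : ∀ t : ℝ, 0 ≤ t → tau g t 0 = tau g T 0 → t = T) (c : ℝ) :
    T < c ↔ ∃ s : ℚ, 0 < s ∧ (s : ℝ) < c ∧ ∀ t : ℚ, 0 < t → c ≤ t → tau g t 0 < tau g s 0 := by
  have hcont : Continuous fun t : Set.Ici (0 : ℝ) => tau g t 0 :=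
    (continuous_tau hc).comp (by fun_prop : Continuous fun t : Set.Ici (0 : ℝ) => (t, (0 : Plane)))
  have hcw : ∀ s : ℝ, 0 ≤ s → ContinuousWithinAt (fun t : ℝ => tau g t 0) (Set.Ioi s) s :=
    fun s hs => ((continuousOn_iff_continuous_domRestrict.2 hcont) s hs).mono
      fun t ht => hs.trans (le_of_lt ht)
  constructor
  · intro hTc
    have hτ : 0 < tau g T 0 := (tau_pos_of_lt hs₀ hpos).trans_le (hmax s₀ hs₀.le)
    obtain ⟨t₀, ht₀⟩ := eventually_atTop.1 (hg.eventually_tau_le hc.continuous 0 (half_pos hτ))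
    have hF : Continuous fun p : Set.Ici (0 : ℝ) × Unit => tau g p.1 0 := hcont.comp continuous_fst
    -- With a one-point parameter space, this yields a strict gap between the maximum and all slopes
    -- from time `c` on.
    obtain ⟨m, hm, hfar⟩ := exists_lt_eventually_forall_le_of_unique_max
      (F := fun (t : Set.Ici (0 : ℝ)) (_ : Unit) => tau g t 0) (T := ⟨T, hT⟩) (x₀ := ())
      (m := tau g T 0 / 2) hF
      (fun t ht => (hmax t t.2).lt_of_ne fun h => ht (Subtype.ext (huniq t t.2 h)))
      (isCompact_setOf_coe_le t₀) (half_lt_self hτ)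
      (Eventually.of_forall fun _ t ht => ht₀ t (not_le.1 ht).le 0 (by simp))
      (U := {t | (t : ℝ) < c}) (isOpen_lt continuous_subtype_val continuous_const) hTc
    have hfar' := hfar.self_of_nhds
    obtain ⟨w, hw, hsub⟩ := mem_nhdsGT_iff_exists_Ioo_subset.1
      ((hcw T hT).eventually (eventually_gt_nhds hm))
    obtain ⟨s, hs1, hs2⟩ := exists_rat_btwn (lt_min (Set.mem_Ioi.1 hw) hTc)
    refine ⟨s, by exact_mod_cast hT.trans_lt hs1, hs2.trans_le (min_le_right _ _),
      fun t ht hct => ?_⟩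
    have h1 : m < tau g s 0 := hsub ⟨hs1, hs2.trans_le (min_le_left _ _)⟩
    exact (hfar' ⟨t, Set.mem_Ici.2 (by exact_mod_cast ht.le)⟩ (not_lt.2 hct)).trans_lt h1
  · rintro ⟨s, hs, hsc, hlt⟩
    by_contra! hcT
    have hs0 : (0 : ℝ) < s := by exact_mod_cast hs
    -- Otherwise rational times just after `T ≥ c` would have slopes above that of `s`.
    have hle : tau g T 0 ≤ tau g s 0 := by
      by_contra! h
      obtain ⟨w, hw, hsub⟩ := mem_nhdsGT_iff_exists_Ioo_subset.1
        ((hcw T hT).eventually (eventually_gt_nhds h))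
      obtain ⟨t, ht1, ht2⟩ := exists_rat_btwn (Set.mem_Ioi.1 hw)
      exact (hlt t (by exact_mod_cast hT.trans_lt ht1) (hcT.trans ht1.le)).not_gt (hsub ⟨ht1, ht2⟩)
    have := huniq s hs0.le (le_antisymm (hmax s hs0.le) hle)
    linarith

variable {Ω : Type*} [MeasurableSpace Ω] {P : Measure Ω}

/-- The maximizer of the slopes at `0` of a random function can be chosen measurably. -/
theorem exists_measurable_maximizer {f : Ω → Plane → ℝ}
    (hf : ∀ s : ℝ, AEMeasurable (fun ω => f ω (s • unitVec 0)) P)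
    (hg : ∀ᵐ ω ∂P, HasSqrtGrowth (f ω)) (hc : ∀ᵐ ω ∂P, ContDiff ℝ 1 (f ω))
    (hpos : ∀ᵐ ω ∂P, ∃ s : ℝ, 0 < s ∧ f ω 0 < f ω (s • unitVec 0))
    (huniq : ∀ᵐ ω ∂P, ∀ s t : ℝ, 0 ≤ s → 0 ≤ t →
      (∀ r : ℝ, 0 ≤ r → tau (f ω) r 0 ≤ tau (f ω) s 0) →
      (∀ r : ℝ, 0 ≤ r → tau (f ω) r 0 ≤ tau (f ω) t 0) → s = t) :
    ∃ T : Ω → ℝ, Measurable T ∧ ∀ᵐ ω ∂P, 0 ≤ T ω ∧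
      (∀ t : ℝ, 0 ≤ t → tau (f ω) t 0 ≤ tau (f ω) (T ω) 0) ∧
      ∀ t : ℝ, 0 ≤ t → tau (f ω) t 0 = tau (f ω) (T ω) 0 → t = T ω := by
  classical
  have hex : ∀ᵐ ω ∂P, ∃ T : ℝ, 0 ≤ T ∧ (∀ t : ℝ, 0 ≤ t → tau (f ω) t 0 ≤ tau (f ω) T 0) ∧
      ∀ t : ℝ, 0 ≤ t → tau (f ω) t 0 = tau (f ω) T 0 → t = T := by
    filter_upwards [hg, hc, hpos, huniq] with ω h1 h2 ⟨s, hs, h3⟩ h4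
    obtain ⟨T, hT, hmax⟩ := h1.exists_forall_tau_le h2 hs h3
    exact ⟨T, hT, hmax, fun t ht h => h4 t T ht hT (fun r hr => h ▸ hmax r hr) hmax⟩
  set T : Ω → ℝ := fun ω => if h : ∃ T : ℝ, 0 ≤ T ∧
      (∀ t : ℝ, 0 ≤ t → tau (f ω) t 0 ≤ tau (f ω) T 0) ∧
      ∀ t : ℝ, 0 ≤ t → tau (f ω) t 0 = tau (f ω) T 0 → t = T then h.choose else 0 with hTdef
  have hT : ∀ᵐ ω ∂P, 0 ≤ T ω ∧ (∀ t : ℝ, 0 ≤ t → tau (f ω) t 0 ≤ tau (f ω) (T ω) 0) ∧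
      ∀ t : ℝ, 0 ≤ t → tau (f ω) t 0 = tau (f ω) (T ω) 0 → t = T ω := by
    filter_upwards [hex] with ω h
    simp only [hTdef, dif_pos h]
    exact h.choose_spec
  have hτ : ∀ t : ℚ, 0 < t → AEMeasurable (fun ω => tau (f ω) t 0) P := by
    intro t ht
    have ht' : (0 : ℝ) < t := by exact_mod_cast ht
    simp only [tau_of_pos ht', zero_add, smul_eq_mul]
    have h0 := hf 0
    rw [zero_smul] at h0
    exact ((hf t).sub h0).const_mul _
  -- `T` comes from choice, but {T < c} agrees up to a null set with a countable combination of
  -- events on rational slopes.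
  have hTm : NullMeasurable T P := by
    suffices h : ∀ c, NullMeasurableSet (T ⁻¹' Set.Iio c) P from
      fun s hs => measurable_of_Iio (δ := NullMeasurableSpace Ω P) (f := T) h hs
    intro c
    have hset : {ω | ∃ s : ℚ, 0 < s ∧ (s : ℝ) < c ∧
        ∀ t : ℚ, 0 < t → c ≤ t → tau (f ω) t 0 < tau (f ω) s 0} =ᵐ[P] T ⁻¹' Set.Iio c := by
      filter_upwards [hT, hg, hc, hpos] with ω h1 h2 h3 ⟨s, hs, h4⟩
      exact propext
        (lt_iff_exists_rat_forall_rat_tau_lt h2 h3 hs h4 h1.1 h1.2.1 h1.2.2 c).symm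
    refine NullMeasurableSet.congr ?_ hset
    simp only [Set.ofPred_exists, Set.ofPred_and, Set.ofPred_forall]
    refine NullMeasurableSet.iUnion fun s => ?_
    by_cases hs : 0 < s
    · refine (NullMeasurableSet.const _).inter ((NullMeasurableSet.const _).inter ?_)
      refine NullMeasurableSet.iInter fun t => NullMeasurableSet.iInter fun ht =>
        NullMeasurableSet.iInter fun _ => nullMeasurableSet_lt (hτ t ht) (hτ s hs)
    · simp [hs]
  have hTa := hTm.aemeasurable
  refine ⟨hTa.mk T, hTa.measurable_mk, ?_⟩
  filter_upwards [hT, hTa.ae_eq_mk] with ω h1 h2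
  rwa [← h2]

end Maximizer

/-! ### The gradient of the slope field at the origin. -/

theorem proposition2p2 {Ω : Type*} [MeasurableSpace Ω] (P : Measure Ω) [IsProbabilityMeasure P]
    (q : Plane → ℝ) (hq : IsAdmissibleKernel q)
    (W : Lp ℝ 2 (volume : Measure Plane) → Ω → ℝ) (hW : IsWhiteNoise P W)
    (f : Ω → Plane → ℝ) (hf : IsConvolvedNoise P W hq.memLp_self f) :
    ∃ T : Ω → ℝ, Measurable T ∧ ∀ᵐ ω ∂P,
      (∀ z, BddAbove (Set.range fun t : Set.Ici (0 : ℝ) => tau (f ω) t z)) ∧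
      0 ≤ T ω ∧
      slopeField (f ω) 0 = tau (f ω) (T ω) 0 ∧
      (∀ t : ℝ, 0 ≤ t → slopeField (f ω) 0 = tau (f ω) t 0 → t = T ω) ∧
      HasGradientAt (slopeField (f ω)) (tau (∇ (f ω)) (T ω) 0) 0 := by
  have hg := hf.ae_hasSqrtGrowth hW
  have hpos := hf.ae_exists_lt hq hW
  have hc1 : ∀ᵐ ω ∂P, ContDiff ℝ 1 (f ω) := hf.ae_contDiff.mono fun ω h => h.of_le (by norm_num)
  obtain ⟨T, hTm, hT⟩ := exists_measurable_maximizer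
    (fun s => (hW.aemeasurable _).congr (ae_eq_symm (hf.ae_eq (s • unitVec 0)))) hg hc1 hpos
    (hf.ae_unique_max hq hW)
  refine ⟨T, hTm, ?_⟩
  filter_upwards [hg, hc1, hf.ae_contDiff, hpos, hT] with ω h1 h2 h3 ⟨s, hs, h4⟩ ⟨hT0, hmax, huniq⟩
  have hslope := slopeField_eq_of_forall_tau_le hT0 hmax
  refine ⟨h1.bddAbove_tau h2, hT0, hslope, fun t ht h => huniq t ht (h.symm.trans hslope),
    h1.hasGradientAt_slopeField h3 hs h4 hT0 hmax huniq⟩
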